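/- All vector spaces are over $\mathbb{C}$. A left Leibniz algebra is a vector space $L$ with a bilinear bracket satisfying $[x,[y,z]]=[[x,y],z]+[y,[x,z]]$; $\mathrm{Leib}(L)$ is the span of all $[x,x]$. $L$ is a Lie algebra if $\mathrm{Leib}(L)=0$, and $L$ is simple if $[L,L]\neq\mathrm{Leib}(L)$ and $0$, $\mathrm{Leib}(L)$, $L$ are its only two-sided ideals. Let $(A,*)$ be a unital commutative associative algebra with identity $\hat 1$. A vertex $A$-algebroid is a left Leibniz algebra $B$ with a bilinear map $A\times B\to B$, $(a,v)\mapsto a\cdot v$, such that $\hat 1\cdot v=v$, a homomorphism of Leibniz algebras $\pi:B\to\mathrm{Der}(A)$, a symmetric bilinear map $\langle\,,\rangle:B\times B\to A$ and a linear map $\partial:A\to B$ with $\pi\circ\partial=0$, such that for all $a,a'\in A$ and $u,v,v_1,v_2\in B$ $$a\cdot(a'\cdot v)-(a*a')\cdot v=\pi(v)(a)\cdot\partial a'+\pi(v)(a')\cdot\partial a,\quad [u,a\cdot v]=\pi(u)(a)\cdot v+a\cdot[u,v],\quad [u,v]+[v,u]=\partial\langle u,v\rangle,$$ $$\pi(a\cdot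 v)=a\,\pi(v),\quad \langle a\cdot u,v\rangle=a*\langle u,v\rangle-\pi(u)(\pi(v)(a)),\quad \pi(v)\langle v_1,v_2\rangle=\langle[v,v_1],v_2\rangle+\langle v_1,[v,v_2]\rangle,$$ $$\partial(a*a')=a\cdot\partial a'+a'\cdot\partial a,\quad [v,\partial a]=\partial(\pi(v)(a)),\quad \langle v,\partial a\rangle=\pi(v)(a).$$ Write $u_0v=[u,v]$, $u_1v=\langle u,v\rangle$, $u_0a=\pi(u)(a)$. An isomorphism from a vertex $A$-algebroid $B$ to a vertex $A'$-algebroid $B'$ is an algebra isomorphism $A\to A'$ together with a linear isomorphism $B\to B'$ that are compatible with all these operations. For a finite-dimensional simple Lie algebra $\mathfrak g$, the normalized invariant form is the nondegenerate symmetric invariant bilinear form on $\mathfrak g$ for which, after the identification of each Cartan subalgebra with its dual by means of the form, $(\alpha,\alpha)=2$ for all long roots $\alpha$. Given a Cartan subalgebra $\mathfrak h$, a choice of positive roots, and $\lambda\in\mathfrak h^*$, $L(\lambda)$ denotes the quotient of the Verma module $V(\lambda)$ by its maximal proper submodule; $\lambda$ is dominant integral if $\lambda(h_\alpha)\in\mathbb{Z}_{\ge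 0}$ for all positive roots $\alpha$, where $h_\alpha$ is the coroot of $\alpha$. Let $(\,,)$ be a symmetric invariant bilinear form on $\mathfrak g$ such that $xym+yxm=(x,y)m$ for all $x,y\in\mathfrak g$, $m\in L(\lambda)$. Then $B_\lambda=\mathfrak g\oplus L(\lambda)$ denotes the vertex algebroid over $A_\lambda=\mathbb{C}1\oplus L(\lambda)$, where $1$ is the identity and $L(\lambda)*L(\lambda)=0$, with the following operations, for $x,y\in\mathfrak g$, $m,n,a\in L(\lambda)$: $\partial 1=0$ and $\partial$ maps the summand $L(\lambda)$ of $A_\lambda$ identically onto the summand $L(\lambda)$ of $B_\lambda$; $[x+m,y+n]=[x,y]+xn$; $(x+m)_0 1=0$ and $(x+m)_0a=xa$; $\langle x+m,y+n\rangle=(x,y)1+xn+ym$; $1\cdot(x+m)=x+m$ and $a\cdot(x+m)=\partial(xa)$. **Theorem.** Let $(A,*)$ be a finite-dimensional unital commutative associative algebra and $B$ a finite-dimensional vertex $A$-algebroid that is a simple Leibniz algebra but not a Lie algebra. Then there is a simple Lie algebra $\mathfrak g\subset B$ (a subspace closed under the bracket of $B$) such that $B=\mathfrak g\oplus\partial(A)$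 and $\partial(A)$ is a simple $\mathfrak g$-module, and there is a $\mathfrak g$-submodule $N$ of $A$ with $A=\mathbb{C}\hat 1\oplus N$. For any simple Lie algebra $\mathfrak g\subset B$ with $B=\mathfrak g+\partial(A)$ and $\partial(A)$ a simple $\mathfrak g$-module, and any $\mathfrak g$-submodule $N$ of $A$ with $A=\mathbb{C}\hat 1\oplus N$, assume that $u_1v\neq 0$ for some $u,v\in\mathfrak g$, that $\operatorname{Ker}\partial=\mathbb{C}\hat 1$, and that $a\cdot b\in\partial(A)$ for all $a\in N$, $b\in B$. Then there is a bilinear form $(\,,)$ on $\mathfrak g$ with $(b,b')\hat 1=b_1b'$ for all $b,b'\in\mathfrak g$, and (i) $(\,,)$ is the normalized invariant form of $\mathfrak g$; (ii) $A$ is a local algebra, and $a*a'=0$ for all $a,a'\in N$; (iii) for all $a\in N$, $u,v\in\mathfrak g$ and $a'\in A$, $a\cdot(u+\partial a')=\partial(u_0a)$ and $u_0v_0a+v_0u_0a=(u_1v)*a$. Moreover, for every Cartan subalgebra of $\mathfrak g$ and every choice of positive roots there is a dominant integral $\lambda$ such that $xym+yxm=(x,y)m$ for all $x,y\in\mathfrak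 g$, $m\in L(\lambda)$, and $B\cong B_\lambda$ as vertex algebroids, where $B_\lambda$ is formed with the form $(\,,)$. -/

import Mathlib

noncomputable section

/-! ### Left Leibniz algebras over the complex numbers -/

/-- A left Leibniz algebra structure on a complex vector space `L`. -/
structure LeibnizAlgebra (L : Type*) [AddCommGroup L] [Module ℂ L] where
  /-- the bracket `[x, y]` -/
  bracket : L →ₗ[ℂ] L →ₗ[ℂ] L
  leibniz : ∀ x y z, bracket x (bracket y z) = bracket (bracket x y) z + bracket y (bracket x z)

namespace LeibnizAlgebra

variable {L : Type*} [AddCommGroup L] [Module ℂ L] (𝔏 : LeibnizAlgebra L)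

/-- `Leib(L)`, the span of all squares `[x, x]`. -/
def leib : Submodule ℂ L := Submodule.span ℂ {z | ∃ x, z = 𝔏.bracket x x}

/-- `[L, L]`, the span of all brackets. -/
def derived : Submodule ℂ L := Submodule.span ℂ {z | ∃ x y, z = 𝔏.bracket x y}

/-- Two-sided ideals. -/
def IsIdeal (I : Submodule ℂ L) : Prop :=
  ∀ x, ∀ y ∈ I, 𝔏.bracket x y ∈ I ∧ 𝔏.bracket y x ∈ I

/-- `L` is simple: `[L, L] ≠ Leib(L)`, and `0`, `Leib(L)`, `L` are the only ideals. -/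
structure IsSimple : Prop where
  derived_ne_leib : 𝔏.derived ≠ 𝔏.leib
  eq_of_isIdeal : ∀ I : Submodule ℂ L, 𝔏.IsIdeal I → I = ⊥ ∨ I = 𝔏.leib ∨ I = ⊤

/-- The Leibniz algebra is a Lie algebra. -/
def IsLie : Prop := ∀ x, 𝔏.bracket x x = 0

/-- A Lie algebra inside a Leibniz algebra: a subspace closed under the bracket
on which the bracket is alternating. -/
structure LieSub extends Submodule ℂ L where
  bracket_mem : ∀ {x y : L}, x ∈ carrier → y ∈ carrier → 𝔏.bracket x y ∈ carrier
  bracket_self : ∀ {x : L}, x ∈ carrier → 𝔏.bracket x x = 0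

instance (𝔤 : 𝔏.LieSub) : LieRing 𝔤.toSubmodule where
  bracket x y := ⟨𝔏.bracket x y, 𝔤.bracket_mem x.2 y.2⟩
  add_lie x y z := Subtype.ext (by simp)
  lie_add x y z := Subtype.ext (by simp)
  lie_self x := Subtype.ext (𝔤.bracket_self x.2)
  leibniz_lie x y z := Subtype.ext (𝔏.leibniz x y z)

instance (𝔤 : 𝔏.LieSub) : LieAlgebra ℂ 𝔤.toSubmodule where
  lie_smul c x y := Subtype.ext (by simp [Bracket.bracket])

end LeibnizAlgebra

/-! ### Vertex algebroids -/

/-- A vertex `A`-algebroid structure on the complex vector space `B`. In the notation of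
1-truncated conformal algebras, `u_0 v = [u, v]`, `u_1 v = ⟨u, v⟩` and `u_0 a = π(u)(a)`. -/
structure VertexAlgebroid (A B : Type*) [CommRing A] [Algebra ℂ A] [AddCommGroup B] [Module ℂ B]
    extends LeibnizAlgebra B where
  /-- the (nonassociative) action `a · v` -/
  act : A →ₗ[ℂ] B →ₗ[ℂ] B
  /-- the anchor `π : B → Der(A)` -/
  anchor : B →ₗ[ℂ] Derivation ℂ A A
  /-- the pairing `⟨u, v⟩` -/
  pairing : B →ₗ[ℂ] B →ₗ[ℂ] A
  /-- the map `∂ : A → B` -/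
  d : A →ₗ[ℂ] B
  one_act : ∀ v, act 1 v = v
  anchor_bracket : ∀ u v, anchor (bracket u v) = ⁅anchor u, anchor v⁆
  pairing_symm : ∀ u v, pairing u v = pairing v u
  anchor_d : ∀ a, anchor (d a) = 0
  act_act : ∀ a a' v, act a (act a' v) - act (a * a') v =
    act (anchor v a) (d a') + act (anchor v a') (d a)
  bracket_act : ∀ u a v, bracket u (act a v) = act (anchor u a) v + act a (bracket u v)
  bracket_add_bracket : ∀ u v, bracket u v + bracket v u = d (pairing u v)
  anchor_act : ∀ a v, anchor (act a v) = a • anchor v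
  pairing_act : ∀ a u v, pairing (act a u) v = a * pairing u v - anchor u (anchor v a)
  anchor_pairing : ∀ v v₁ v₂, anchor v (pairing v₁ v₂) =
    pairing (bracket v v₁) v₂ + pairing v₁ (bracket v v₂)
  d_mul : ∀ a a', d (a * a') = act a (d a') + act a' (d a)
  bracket_d : ∀ v a, bracket v (d a) = d (anchor v a)
  pairing_d : ∀ v a, pairing v (d a) = anchor v a

namespace VertexAlgebroid

section

variable {A B : Type*} [CommRing A] [Algebra ℂ A] [AddCommGroup B] [Module ℂ B]
  {A' B' : Type*} [CommRing A'] [Algebra ℂ A'] [AddCommGroup B'] [Module ℂ B']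

/-- The pair `(f, g)` is a homomorphism of vertex algebroids. -/
structure IsHom (V : VertexAlgebroid A B) (V' : VertexAlgebroid A' B')
    (f : A →ₐ[ℂ] A') (g : B →ₗ[ℂ] B') : Prop where
  map_bracket : ∀ u v, g (V.bracket u v) = V'.bracket (g u) (g v)
  map_act : ∀ a v, g (V.act a v) = V'.act (f a) (g v)
  map_pairing : ∀ u v, f (V.pairing u v) = V'.pairing (g u) (g v)
  map_d : ∀ a, g (V.d a) = V'.d (f a)
  map_anchor : ∀ v a, f (V.anchor v a) = V'.anchor (g v) (f a)

/-- Two vertex algebroids (over possibly different algebras) are isomorphic. -/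
def Isomorphic (V : VertexAlgebroid A B) (V' : VertexAlgebroid A' B') : Prop :=
  ∃ (f : A ≃ₐ[ℂ] A') (g : B ≃ₗ[ℂ] B'), V.IsHom V' f.toAlgHom g.toLinearMap

variable (V : VertexAlgebroid A B)

/-- `∂(A)` is a simple module over the Lie algebra `𝔤 ⊆ B`. -/
def RangeIsSimple (𝔤 : V.LieSub) : Prop :=
  LinearMap.range V.d ≠ ⊥ ∧
    ∀ W : Submodule ℂ B, W ≤ LinearMap.range V.d →
      (∀ x ∈ 𝔤.toSubmodule, ∀ w ∈ W, V.bracket x w ∈ W) → W = ⊥ ∨ W = LinearMap.range V.d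

/-- `N` is a `𝔤`-submodule of `A` with `A = ℂ1 ⊕ N`. -/
def IsInvariantComplement (𝔤 : V.LieSub) (N : Submodule ℂ A) : Prop :=
  (∀ x ∈ 𝔤.toSubmodule, ∀ a ∈ N, V.anchor x a ∈ N) ∧ IsCompl (Submodule.span ℂ {(1 : A)}) N

end

section ofLieModule

open TrivSqZeroExt

variable {𝔤 : Type*} [LieRing 𝔤] [LieAlgebra ℂ 𝔤]
  {M : Type*} [AddCommGroup M] [Module ℂ M] [Module ℂᵐᵒᵖ M] [IsCentralScalar ℂ M]
  [LieRingModule 𝔤 M] [LieModule ℂ 𝔤 M]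

/-- The derivation of `ℂ ⊕ M` (with `M * M = 0`) given by the action of `x ∈ 𝔤` on `M`. -/
def lieDerivation (x : 𝔤) : Derivation ℂ (TrivSqZeroExt ℂ M) (TrivSqZeroExt ℂ M) :=
  Derivation.mk' (inrHom ℂ M ∘ₗ LieModule.toEnd ℂ 𝔤 M x ∘ₗ sndHom ℂ M) (by
    intro a b
    ext
    · simp
    · change ⁅x, (a * b).snd⁆ = (a * inr ⁅x, b.snd⁆ + b * inr ⁅x, a.snd⁆).snd
      simp only [snd_mul, snd_add, fst_inr, snd_inr, op_smul_eq_smul, lie_add, lie_smul, zero_smul,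
        add_zero])

/-- The vertex algebroid on `𝔤 ⊕ M` over `ℂ ⊕ M`, `M * M = 0`, attached to a `𝔤`-module `M` and a
symmetric invariant form `φ` on `𝔤` such that `xym + yxm = φ(x, y)m`. Here
`∂` is the projection `ℂ ⊕ M → M` followed by the inclusion `M → 𝔤 ⊕ M`, and
* `[x + m, y + n] = [x, y] + x n`, and `(x + m)_0 a = x a`;
* `⟨x + m, y + n⟩ = φ(x, y) + x n + y m`;
* `1 · v = v`, and `a · (x + m) = ∂(x a)` for `a ∈ M`. -/
def ofLieModule (φ : LinearMap.BilinForm ℂ 𝔤) (hs : φ.IsSymm) (hi : φ.lieInvariant 𝔤)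
    (hφ : ∀ (x y : 𝔤) (m : M), ⁅x, ⁅y, m⁆⁆ + ⁅y, ⁅x, m⁆⁆ = φ x y • m) :
    VertexAlgebroid (TrivSqZeroExt ℂ M) (𝔤 × M) where
  bracket := LinearMap.mk₂ ℂ (fun u v => (⁅u.1, v.1⁆, ⁅u.1, v.2⁆))
    (by intros; simp) (by intros; simp) (by intros; simp) (by intros; simp)
  leibniz x y z := by ext <;> simp
  act := LinearMap.mk₂ ℂ (fun a v => (a.fst • v.1, a.fst • v.2 + ⁅v.1, a.snd⁆))
    (by intros; ext <;> simp [add_smul]; abel) (by intros; ext <;> simp [mul_smul])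
    (by intros; ext <;> simp; abel) (by
      intro c a v
      ext
      · simp [smul_comm a.fst c v.1]
      · simp [smul_comm a.fst c v.2])
  anchor :=
    { toFun := fun u => lieDerivation u.1
      map_add' := by intros; ext <;> simp [lieDerivation]
      map_smul' := by intros; ext <;> simp [lieDerivation] }
  pairing := LinearMap.mk₂ ℂ (fun u v => inl (φ u.1 v.1) + inr (⁅u.1, v.2⁆ + ⁅v.1, u.2⁆))
    (by intros; ext <;> simp; abel) (by intros; ext <;> simp)
    (by intros; ext <;> simp; abel) (by intros; ext <;> simp)
  d := LinearMap.inr ℂ 𝔤 M ∘ₗ sndHom ℂ M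
  one_act v := by simp
  anchor_bracket u v := by
    ext a <;> simp [lieDerivation, Derivation.commutator_apply]
  pairing_symm u v := by
    ext
    · simpa using hs.eq u.1 v.1
    · simp [add_comm]
  anchor_d a := by ext <;> simp [lieDerivation]
  act_act a a' v := by
    ext
    · simp [lieDerivation, mul_smul]
    · simp [lieDerivation, mul_smul]
      abel
  bracket_act u a v := by
    ext
    · simp [lieDerivation]
    · simp [lieDerivation]
      abel
  bracket_add_bracket u v := by
    ext
    · change ⁅u.1, v.1⁆ + ⁅v.1, u.1⁆ = 0
      rw [← lie_skew u.1 v.1, neg_add_cancel]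
    · simp
  anchor_act a v := by
    ext
    · simp [lieDerivation]
    · simp [lieDerivation]
  pairing_act a u v := by
    ext
    · simp [lieDerivation]
    · simp [lieDerivation]
      rw [← hφ u.1 v.1 a.snd]
      abel
  anchor_pairing v v₁ v₂ := by
    ext
    · simp [lieDerivation, hi v.1 v₁.1 v₂.1]
    · simp [lieDerivation]
      abel
  d_mul a a' := by
    ext <;> simp
  bracket_d v a := by ext <;> simp [lieDerivation]
  pairing_d v a := by ext <;> simp [lieDerivation]

end ofLieModule

end VertexAlgebroid

/-! ### Highest weight modules of a semisimple Lie algebra -/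

namespace HighestWeight

open LieAlgebra LieAlgebra.IsKilling

variable {𝔤 : Type*} [LieRing 𝔤] [LieAlgebra ℂ 𝔤] [FiniteDimensional ℂ 𝔤] [LieAlgebra.IsKilling ℂ 𝔤]
  {H : LieSubalgebra ℂ 𝔤} [H.IsCartanSubalgebra]

/-- The weight `lam` is dominant integral for the positive system attached to the base `b`:
`lam(h_α)` is a nonnegative integer for every positive root `α`. -/
def IsDominantIntegral (b : (rootSystem H).Base) (lam : Module.Dual ℂ H) : Prop :=
  ∀ α : H.root, b.IsPos α → ∃ n : ℕ, lam (coroot α.1) = n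

/-- The left ideal of `U(𝔤)` generated by all positive root vectors and all `h - lam(h)`,
`h ∈ H`. -/
def vermaIdeal (b : (rootSystem H).Base) (lam : Module.Dual ℂ H) :
    Ideal (UniversalEnvelopingAlgebra ℂ 𝔤) :=
  Ideal.span
    ({u | ∃ α : H.root, b.IsPos α ∧ ∃ e ∈ rootSpace H α.1, u = UniversalEnvelopingAlgebra.ι ℂ e} ∪
      {u | ∃ h : H, u = UniversalEnvelopingAlgebra.ι ℂ (h : 𝔤) -
        algebraMap ℂ (UniversalEnvelopingAlgebra ℂ 𝔤) (lam h)})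

/-- The Verma module `V(lam)`, as a module over `U(𝔤)`. -/
abbrev Verma (b : (rootSystem H).Base) (lam : Module.Dual ℂ H) : Type _ :=
  UniversalEnvelopingAlgebra ℂ 𝔤 ⧸ vermaIdeal b lam

/-- The maximal proper submodule of `V(lam)`: the sum of all proper submodules. -/
def vermaMaximal (b : (rootSystem H).Base) (lam : Module.Dual ℂ H) :
    Submodule (UniversalEnvelopingAlgebra ℂ 𝔤) (Verma b lam) :=
  sSup {W | W ≠ ⊤}

/-- `L(lam)`, the irreducible highest weight module: the quotient of the Verma module
by its maximal proper submodule. -/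
def Irr (b : (rootSystem H).Base) (lam : Module.Dual ℂ H) : Type _ :=
  Verma b lam ⧸ vermaMaximal b lam

variable (b : (rootSystem H).Base) (lam : Module.Dual ℂ H)

instance : AddCommGroup (Irr b lam) :=
  inferInstanceAs (AddCommGroup (Verma b lam ⧸ vermaMaximal b lam))

instance : Module (UniversalEnvelopingAlgebra ℂ 𝔤) (Irr b lam) :=
  inferInstanceAs (Module (UniversalEnvelopingAlgebra ℂ 𝔤) (Verma b lam ⧸ vermaMaximal b lam))

instance : Module ℂ (Irr b lam) :=
  Module.compHom _ (algebraMap ℂ (UniversalEnvelopingAlgebra ℂ 𝔤))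

instance : IsScalarTower ℂ (UniversalEnvelopingAlgebra ℂ 𝔤) (Irr b lam) :=
  IsScalarTower.of_algebraMap_smul fun _ _ => rfl

/-- The right action of scalars is the left one. -/
instance : Module ℂᵐᵒᵖ (Irr b lam) :=
  Module.compHom _ ((RingHom.id ℂ).fromOpposite fun x y => mul_comm x y)

instance : IsCentralScalar ℂ (Irr b lam) where
  op_smul_eq_smul _ _ := rfl

instance : LieRingModule 𝔤 (Irr b lam) where
  bracket x m := UniversalEnvelopingAlgebra.ι ℂ x • m
  add_lie x y m := by
    rw [map_add, add_smul]
  lie_add x m n := smul_add _ m n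
  leibniz_lie x y m := by
    change UniversalEnvelopingAlgebra.ι ℂ x • UniversalEnvelopingAlgebra.ι ℂ y • m =
      UniversalEnvelopingAlgebra.ι ℂ ⁅x, y⁆ • m +
        UniversalEnvelopingAlgebra.ι ℂ y • UniversalEnvelopingAlgebra.ι ℂ x • m
    have h : UniversalEnvelopingAlgebra.ι ℂ ⁅x, y⁆ =
        UniversalEnvelopingAlgebra.ι ℂ x * UniversalEnvelopingAlgebra.ι ℂ y -
          UniversalEnvelopingAlgebra.ι ℂ y * UniversalEnvelopingAlgebra.ι ℂ x :=
      letI : LieRing (UniversalEnvelopingAlgebra ℂ 𝔤) := LieRing.ofAssociativeRing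
      LieHom.map_lie (UniversalEnvelopingAlgebra.ι ℂ) x y
    rw [h, sub_smul, mul_smul, mul_smul]
    abel

instance : LieModule ℂ 𝔤 (Irr b lam) where
  smul_lie c x m := by
    change UniversalEnvelopingAlgebra.ι ℂ (c • x) • m = c • UniversalEnvelopingAlgebra.ι ℂ x • m
    rw [map_smul, smul_assoc]
  lie_smul c x m := by
    change UniversalEnvelopingAlgebra.ι ℂ x • algebraMap ℂ (UniversalEnvelopingAlgebra ℂ 𝔤) c • m =
      algebraMap ℂ (UniversalEnvelopingAlgebra ℂ 𝔤) c • UniversalEnvelopingAlgebra.ι ℂ x • m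
    rw [← mul_smul, ← mul_smul, Algebra.commutes]

/-- The root `α` is long: its length with respect to the form induced on the dual of `H` by the
Killing form (these lengths are positive rational numbers) is maximal. -/
def IsLongRoot (α : H.root) : Prop :=
  ∀ β : H.root,
    (killingForm ℂ 𝔤 ((cartanEquivDual H).symm β.1.toLinear) ((cartanEquivDual H).symm β.1.toLinear)).re ≤
    (killingForm ℂ 𝔤 ((cartanEquivDual H).symm α.1.toLinear) ((cartanEquivDual H).symm α.1.toLinear)).re

/-- `φ` is the normalized invariant form of `𝔤`: nondegenerate, symmetric, invariant and such that
`⟨α, α⟩ = 2` for every long root `α` (with respect to any Cartan subalgebra `H`), where `H` and its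
dual are identified by means of `φ`. -/
structure IsNormalizedInvariantForm (φ : LinearMap.BilinForm ℂ 𝔤) : Prop where
  isSymm : φ.IsSymm
  nondegenerate : φ.Nondegenerate
  lieInvariant : φ.lieInvariant 𝔤
  long_root : ∀ (H : LieSubalgebra ℂ 𝔤) [H.IsCartanSubalgebra] (α : H.root), IsLongRoot α →
    ∃ t : H, (∀ h : H, φ t h = α.1 h) ∧ φ t t = 2

end HighestWeight

end

/-!
Let `B` be a vertex `A`-algebroid that is a simple Leibniz algebra but not a Lie algebra.

*Levi decomposition.* The ideal `∂(A)` equals `Leib(B)`, and `Leib(B)` annihilates `B` from the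
left. Hence the left multiplications of `B` form a simple Lie algebra `S ≅ B / Leib(B)` acting on
`B`, and an `S`-stable complement of `Leib(B)`, which exists by Weyl's theorem, is a Lie subalgebra
`𝔤` (`LeibnizAlgebra.IsSimple.exists_isCompl_leib`). Since `𝔤` acts on `A` by derivations, Weyl's
theorem also yields the complement `N` of the constants. Weyl's theorem
(`LieModule.exists_isCompl_of_isSimple`) follows from `M = M^𝔤 ⊕ 𝔤 M`, which is proved by
induction from the Fitting decomposition of the Casimir operator of the trace form of `M`; by
Cartan's criterion this form is nondegenerate when the action is nontrivial.

*The structure of `A` and `B`.* As `Ker ∂ = ℂ1`, the map `∂` identifies `N` with `∂(A)`, so `N` is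
irreducible and nontrivial, and the pairing on `𝔤` is an invariant form `φ` times `1`. For `a ∈ N`
the element `a · u` lies in `∂(A)`, so the anchor annihilates it; thus `a * (u_0 a') = 0`, whence
`N * N = 0`. Write `a · u = ∂(F_u a)`. The pairing axiom gives `v F_u = φ(u, v) - u v` on `N`, so
`D_u = F_u - u` satisfies `v D_u = u D_v`, and a computation with the canonical tensor of the trace
form of `N` shows that `D = 0` (`LieModule.eq_lie_of_lie_eq_smul_sub`). Therefore `a · u = ∂(u_0 a)`
and `u v + v u = φ(u, v)` on `N`. For an `sl₂`-triple `h, e, f` this relation forces `φ(h, h) = 2`,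
so that `φ` is the normalized form
(`HighestWeight.isNormalizedInvariantForm_of_anticommutator`).

*Identification with `L(λ)`.* A finite-dimensional irreducible module contains a vector of dominant
integral highest weight, hence is a quotient of a Verma module by a maximal submodule. Proper
submodules of a Verma module avoid the highest weight space, so a maximal submodule contains all of
them (`HighestWeight.IsHighestWeightVector.le_of_isCoatom`), and the quotient is `L(λ)`. All
operations of `B` having been computed, `N ≅ L(λ)` extends to an isomorphism of vertex algebroids
(`VertexAlgebroid.IsInvariantComplement.isomorphic_ofLieModule`).
-/

/-! ### Casimir operators -/

namespace LieModule

open LinearMap (BilinForm)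

section Casimir

variable {K L : Type*} [Field K] [LieRing L] [LieAlgebra K L]
  {ι : Type*} [Fintype ι] [DecidableEq ι]
  {B : BilinForm K L} (hB : B.Nondegenerate) (hs : B.IsSymm) (b : Module.Basis ι K L)

include hs in
lemma sum_apply_dualBasis_smul (x : L) : ∑ j, B (B.dualBasis hB b j) x • b j = x := by
  conv_rhs => rw [← (B.dualBasis hB (B.dualBasis hB b)).sum_repr x]
  refine Finset.sum_congr rfl fun j _ => ?_
  rw [BilinForm.dualBasis_repr_apply, BilinForm.dualBasis_dualBasis hB hs b, hs.eq]

variable {X : Type*} [AddCommGroup X] [Module K X]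

include hs in
/-- The canonical tensor `∑ bᵢ ⊗ bⁱ` of an invariant form is invariant. -/
lemma sum_lie_dualBasis_add (hi : B.lieInvariant L) (Φ : L →ₗ[K] L →ₗ[K] X) (v : L) :
    ∑ i, Φ ⁅v, b i⁆ (B.dualBasis hB b i) + ∑ i, Φ (b i) ⁅v, B.dualBasis hB b i⁆ = 0 := by
  have h1 (i : ι) : Φ ⁅v, b i⁆ (B.dualBasis hB b i) =
      ∑ j, B (B.dualBasis hB b j) ⁅v, b i⁆ • Φ (b j) (B.dualBasis hB b i) := by
    conv_lhs => rw [← sum_apply_dualBasis_smul hB hs b ⁅v, b i⁆]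
    simp
  have h2 (i : ι) : Φ (b i) ⁅v, B.dualBasis hB b i⁆ =
      ∑ j, B ⁅v, B.dualBasis hB b i⁆ (b j) • Φ (b i) (B.dualBasis hB b j) := by
    conv_lhs => rw [← (B.dualBasis hB b).sum_repr ⁅v, B.dualBasis hB b i⁆]
    simp [BilinForm.dualBasis_repr_apply]
  simp_rw [h1, h2]
  rw [Finset.sum_comm, ← Finset.sum_add_distrib]
  refine Finset.sum_eq_zero fun i _ => ?_
  rw [← Finset.sum_add_distrib]
  refine Finset.sum_eq_zero fun j _ => ?_
  rw [← add_smul, hi, add_neg_cancel, zero_smul]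

include hs in
/-- The canonical tensor `∑ bᵢ ⊗ bⁱ` of a symmetric form is symmetric. -/
lemma sum_dualBasis_comm (Φ : L →ₗ[K] L →ₗ[K] X) :
    ∑ i, Φ (b i) (B.dualBasis hB b i) = ∑ i, Φ (B.dualBasis hB b i) (b i) := by
  have h1 (i : ι) : Φ (b i) (B.dualBasis hB b i) =
      ∑ j, B (B.dualBasis hB b j) (B.dualBasis hB b i) • Φ (b i) (b j) := by
    conv_lhs => rw [← sum_apply_dualBasis_smul hB hs b (B.dualBasis hB b i)]
    simp
  have h2 (i : ι) : Φ (B.dualBasis hB b i) (b i) =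
      ∑ j, B (B.dualBasis hB b j) (B.dualBasis hB b i) • Φ (b j) (b i) := by
    conv_lhs => rw [← sum_apply_dualBasis_smul hB hs b (B.dualBasis hB b i)]
    simp
  simp_rw [h1, h2]
  rw [Finset.sum_comm]
  refine Finset.sum_congr rfl fun i _ => Finset.sum_congr rfl fun j _ => ?_
  rw [hs.eq]

variable (M : Type*) [AddCommGroup M] [Module K M] [LieRingModule L M] [LieModule K L M]

/-- The Casimir operator `∑ bᵢ bⁱ` on `M` of a nondegenerate form on `L`, formed with a basis `b`
and its dual basis with respect to the form. -/
noncomputable def casimir : Module.End K M :=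
  ∑ i, toEnd K L M (b i) * toEnd K L M (B.dualBasis hB b i)

lemma casimir_apply (m : M) : casimir hB b M m = ∑ i, ⁅b i, ⁅B.dualBasis hB b i, m⁆⁆ := by
  simp [casimir]

include hs in
lemma casimir_lie (hi : B.lieInvariant L) (v : L) (m : M) :
    casimir hB b M ⁅v, m⁆ = ⁅v, casimir hB b M m⁆ := by
  have key := sum_lie_dualBasis_add hB hs b hi
    (LinearMap.mk₂ K (fun x y => ⁅x, ⁅y, m⁆⁆) (by simp) (by simp) (by simp) (by simp)) v
  simp only [LinearMap.mk₂_apply] at key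
  rw [← Finset.sum_add_distrib] at key
  rw [casimir_apply, casimir_apply, lie_sum, eq_comm, ← sub_eq_zero, ← Finset.sum_sub_distrib,
    ← key]
  refine Finset.sum_congr rfl fun i _ => ?_
  rw [leibniz_lie v (b i), leibniz_lie v (B.dualBasis hB b i), lie_add]
  abel

lemma casimir_apply_mem (m : M) :
    casimir hB b M m ∈ ⁅(⊤ : LieIdeal K L), (⊤ : LieSubmodule K L M)⁆ := by
  rw [casimir_apply]
  exact sum_mem fun i _ => LieSubmodule.lie_mem_lie trivial trivial

lemma trace_casimir_traceForm (hB : (traceForm K L M).Nondegenerate) :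
    LinearMap.trace K M (casimir hB b M) = Module.finrank K L := by
  have h (i : ι) : LinearMap.trace K M (toEnd K L M (b i) *
      toEnd K L M ((traceForm K L M).dualBasis hB b i)) = 1 := by
    have := BilinForm.apply_dualBasis_right (B := traceForm K L M) hB
      ⟨fun x y => traceForm_comm K L M x y⟩ b i i
    rwa [if_pos rfl] at this
  rw [casimir, map_sum]
  simp only [h]
  simp [Module.finrank_eq_card_basis b]

end Casimir

/-! ### Complete reducibility -/

/-- The Fitting decomposition of an endomorphism of a Lie module, as a decomposition into Lie
submodules. -/
lemma exists_pow_isCompl_ker_range {K L M : Type*} [Field K] [LieRing L] [LieAlgebra K L]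
    [AddCommGroup M] [Module K M] [LieRingModule L M] [LieModule K L M] [FiniteDimensional K M]
    (T : Module.End K M)
    (hT : ∀ (x : L) (m : M), T ⁅x, m⁆ = ⁅x, T m⁆) :
    ∃ (n : ℕ) (V W : LieSubmodule K L M), IsCompl V W ∧
      (V : Submodule K M) = LinearMap.ker (T ^ (n + 1)) ∧
      (W : Submodule K M) = LinearMap.range (T ^ (n + 1)) := by
  obtain ⟨n, hn⟩ := (T.eventually_isCompl_ker_pow_range_pow).exists_forall_of_atTop
  have hp (k : ℕ) (x : L) (m : M) : (T ^ k) ⁅x, m⁆ = ⁅x, (T ^ k) m⁆ := by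
    induction k with
    | zero => rfl
    | succ k ih => rw [pow_succ', Module.End.mul_apply, ih, hT, Module.End.mul_apply]
  let g : M →ₗ⁅K,L⁆ M := { T ^ (n + 1) with map_lie' := hp (n + 1) _ _ }
  refine ⟨n, g.ker, g.range, ?_, rfl, ?_⟩
  · rw [← LieSubmodule.isCompl_toSubmodule]
    exact hn (n + 1) (Nat.le_succ n)
  · exact g.toSubmodule_range

section Weyl

variable (K L : Type*) [Field K] [LieRing L] [LieAlgebra K L] [LieAlgebra.IsSimple K L]

lemma lie_top_top_of_isSimple : ⁅(⊤ : LieIdeal K L), (⊤ : LieIdeal K L)⁆ = ⊤ := by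
  refine (LieAlgebra.IsSimple.eq_bot_or_eq_top _).resolve_left fun h => ?_
  refine LieAlgebra.IsSimple.non_abelian (R := K) (L := L) ⟨fun x y => ?_⟩
  rw [← LieSubmodule.mem_bot (R := K) (L := L), ← h]
  exact LieSubmodule.lie_mem_lie trivial trivial

lemma span_lie_eq_top_of_isSimple : Submodule.span K {z : L | ∃ x y : L, ⁅x, y⁆ = z} = ⊤ := by
  have h := LieSubmodule.lieIdeal_oper_eq_linear_span' (⊤ : LieSubmodule K L L) (⊤ : LieIdeal K L)
  rw [lie_top_top_of_isSimple] at h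
  simpa using h.symm

variable {K L} in
lemma nondegenerate_of_isSimple {B : BilinForm K L} (hs : B.IsSymm) (hi : B.lieInvariant L)
    (h0 : B ≠ 0) : B.Nondegenerate := by
  have hbot : LieAlgebra.InvariantForm.orthogonal B hi ⊤ = ⊥ := by
    refine (LieAlgebra.IsSimple.eq_bot_or_eq_top _).resolve_right fun h => h0 ?_
    ext x y
    have hy : y ∈ LieAlgebra.InvariantForm.orthogonal B hi ⊤ := by rw [h]; trivial
    exact (LieAlgebra.InvariantForm.mem_orthogonal B hi ⊤ y).mp hy x trivial
  have key (y : L) (hy : ∀ x, B x y = 0) : y = 0 := by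
    rw [← LieSubmodule.mem_bot (R := K) (L := L), ← hbot]
    exact (LieAlgebra.InvariantForm.mem_orthogonal B hi ⊤ y).mpr fun x _ => hy x
  exact ⟨fun x hx => key x fun y => by rw [hs.eq]; exact hx y, key⟩

variable (M : Type*) [AddCommGroup M] [Module K M] [LieRingModule L M] [LieModule K L M]

include K in
/-- A simple Lie algebra is perfect, so its nilpotent modules are trivial. -/
lemma isTrivial_of_isNilpotent_of_isSimple [hM : IsNilpotent L M] : IsTrivial L M := by
  have key : lowerCentralSeries K L M 1 ≤ lowerCentralSeries K L M 2 := by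
    rw [lowerCentralSeries_succ, lowerCentralSeries_zero, LieSubmodule.lie_le_iff]
    intro x _ m _
    have hx : x ∈ Submodule.span K {z : L | ∃ x y : L, ⁅x, y⁆ = z} := by
      rw [span_lie_eq_top_of_isSimple]; trivial
    induction hx using Submodule.span_induction with
    | mem z hz =>
      obtain ⟨x, y, rfl⟩ := hz
      rw [lie_lie]
      exact sub_mem
        (LieSubmodule.lie_mem_lie trivial (LieSubmodule.lie_mem_lie trivial trivial))
        (LieSubmodule.lie_mem_lie trivial (LieSubmodule.lie_mem_lie trivial trivial))
    | zero => simp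
    | add x y _ _ hx hy => simpa using add_mem (hx trivial) (hy trivial)
    | smul c x _ hx => simpa using (lowerCentralSeries K L M 2).smul_mem c (hx trivial)
  rw [trivial_iff_lower_central_eq_bot K L M]
  obtain ⟨k, hk⟩ := (isNilpotent_iff K L M).mp hM
  have h (n : ℕ) : lowerCentralSeries K L M 1 ≤ lowerCentralSeries K L M (n + 1) := by
    induction n with
    | zero => exact le_rfl
    | succ n ih =>
      refine key.trans ?_
      rw [lowerCentralSeries_succ, lowerCentralSeries_succ _ _ _ (n + 1)]
      exact LieSubmodule.mono_lie_right _ ih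
  rw [eq_bot_iff, ← hk]
  exact (h k).trans (antitone_lowerCentralSeries K L M (Nat.le_succ k))

variable [CharZero K] [FiniteDimensional K M]

/-- By Cartan's criterion, the trace form of a nontrivial module over a simple Lie algebra is
nonzero; its kernel is an ideal. -/
lemma traceForm_nondegenerate_of_isSimple (h : ¬ IsTrivial L M) :
    (traceForm K L M).Nondegenerate := by
  refine nondegenerate_of_isSimple ⟨fun x y => traceForm_comm K L M x y⟩
    (traceForm_lieInvariant K L M) fun h0 => h ?_
  have := isNilpotent_derivedSeries_of_traceForm_eq_zero h0
  have : IsNilpotent L M := by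
    rw [isNilpotent_iff_forall' (R := K)] at this ⊢
    intro x
    refine this ⟨x, ?_⟩
    rw [LieAlgebra.derivedSeries_def, LieAlgebra.derivedSeriesOfIdeal_succ,
      LieAlgebra.derivedSeriesOfIdeal_zero, lie_top_top_of_isSimple]
    trivial
  exact isTrivial_of_isNilpotent_of_isSimple K L M

variable [FiniteDimensional K L]

/-- For a finite-dimensional module over a simple Lie algebra, `M = M^L ⊕ L M`: the Fitting
decomposition of a Casimir operator splits off a part without invariants. -/
lemma isCompl_maxTrivSubmodule_lie_top :
    IsCompl (maxTrivSubmodule K L M) ⁅(⊤ : LieIdeal K L), (⊤ : LieSubmodule K L M)⁆ := by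
  induction hd : Module.finrank K M using Nat.strong_induction_on generalizing M with
  | _ d ih =>
  by_cases htriv : IsTrivial L M
  · rw [(isTrivial_iff_max_triv_eq_top K L M).mp htriv, LieSubmodule.trivial_lie_oper_zero]
    exact isCompl_top_bot
  let b := Module.finBasis K L
  have hB := traceForm_nondegenerate_of_isSimple K L M htriv
  have hs : (traceForm K L M).IsSymm := ⟨fun x y => traceForm_comm K L M x y⟩
  obtain ⟨n, V, W, hVW, hV, hW⟩ := exists_pow_isCompl_ker_range (casimir hB b M)
    (casimir_lie hB hs b M (traceForm_lieInvariant K L M))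
  have hdim : Module.finrank K V < d := by
    rw [← hd]
    refine Submodule.finrank_lt fun htop => ?_
    have hnil : _root_.IsNilpotent (casimir hB b M) :=
      ⟨n + 1, LinearMap.ker_eq_top.mp (hV ▸ htop)⟩
    have := (LinearMap.isNilpotent_trace_of_isNilpotent hnil).eq_zero
    rw [trace_casimir_traceForm, Nat.cast_eq_zero] at this
    have := LieAlgebra.IsSimple.nontrivial K L
    exact Module.finrank_pos.ne' ‹Module.finrank K L = 0›
  have ihV := ih _ hdim V rfl
  have hVlie : (⁅(⊤ : LieIdeal K L), (⊤ : LieSubmodule K L V)⁆).map V.incl =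
      ⁅(⊤ : LieIdeal K L), V⁆ := by
    rw [LieSubmodule.map_bracket_eq]
    simp
  constructor
  · rw [disjoint_iff, eq_bot_iff]
    rintro m ⟨hm, hm'⟩
    replace hm : ∀ x : L, ⁅x, m⁆ = 0 := hm
    have hmV : m ∈ V := by
      rw [← LieSubmodule.mem_toSubmodule, hV, LinearMap.mem_ker, pow_succ, Module.End.mul_apply,
        casimir_apply]
      simp [hm]
    have hm2 : m ∈ ⁅(⊤ : LieIdeal K L), V⁆ ⊔ ⁅(⊤ : LieIdeal K L), W⁆ := by
      rw [← LieSubmodule.lie_sup, hVW.sup_eq_top]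
      exact hm'
    obtain ⟨p, hp, q, hq, rfl⟩ := (LieSubmodule.mem_sup _ _ _).mp hm2
    have hq0 : q = 0 := by
      have h1 : q ∈ W := LieSubmodule.lie_le_right _ _ hq
      have h2 : q ∈ V := by
        simpa using sub_mem hmV (LieSubmodule.lie_le_right _ _ hp)
      have : q ∈ V ⊓ W := ⟨h2, h1⟩
      rwa [hVW.inf_eq_bot] at this
    subst hq0
    rw [add_zero] at hm hmV ⊢
    rw [← hVlie, LieSubmodule.mem_map] at hp
    obtain ⟨p', hp', rfl⟩ := hp
    have : p' ∈ maxTrivSubmodule K L V ⊓ ⁅(⊤ : LieIdeal K L), (⊤ : LieSubmodule K L V)⁆ :=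
      ⟨fun x => Subtype.ext (hm x), hp'⟩
    rw [ihV.inf_eq_bot] at this
    rw [(LieSubmodule.mem_bot p').mp this]
    simp
  · rw [codisjoint_iff, eq_top_iff]
    refine hVW.sup_eq_top.symm.le.trans
      (sup_le (fun v hv => ?_) (le_trans (fun w hw => ?_) le_sup_right))
    · have : (⟨v, hv⟩ : V) ∈
          maxTrivSubmodule K L V ⊔ ⁅(⊤ : LieIdeal K L), (⊤ : LieSubmodule K L V)⁆ := by
        rw [ihV.sup_eq_top]; trivial
      obtain ⟨p, hp, q, hq, hpq⟩ := (LieSubmodule.mem_sup _ _ _).mp this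
      refine (LieSubmodule.mem_sup _ _ _).mpr
        ⟨p, fun x => by simpa using congrArg Subtype.val (hp x), q, ?_, congrArg Subtype.val hpq⟩
      have hq' : V.incl q ∈ ⁅(⊤ : LieIdeal K L), V⁆ := hVlie ▸ LieSubmodule.mem_map_of_mem hq
      have hle : ⁅(⊤ : LieIdeal K L), V⁆ ≤ ⁅(⊤ : LieIdeal K L), (⊤ : LieSubmodule K L M)⁆ :=
        LieSubmodule.mono_lie_right _ le_top
      exact hle hq'
    · rw [← LieSubmodule.mem_toSubmodule, hW] at hw
      obtain ⟨m, rfl⟩ := hw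
      rw [pow_succ', Module.End.mul_apply]
      exact casimir_apply_mem hB b M _

variable {K L M}

/-- **Weyl's theorem** on complete reducibility, for a simple Lie algebra. -/
theorem exists_isCompl_of_isSimple (W : LieSubmodule K L M) :
    ∃ W' : LieSubmodule K L M, IsCompl W W' := by
  -- An invariant `f : M → W` restricting to the identity is found by applying
  -- `M = M^L ⊕ L M` to `Hom(M, W)` and `Hom(W, W)`.
  have key : ∃ f : M →ₗ[K] W, (∀ x : L, ⁅x, f⁆ = 0) ∧ ∀ w : W, f w = w := by
    obtain ⟨f₀ : M →ₗ[K] W, hf₀⟩ := LinearMap.exists_leftInverse_of_injective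
      (W : Submodule K M).subtype
      (Submodule.ker_subtype _)
    let r : (M →ₗ[K] W) →ₗ⁅K,L⁆ (W →ₗ[K] W) :=
      { LinearMap.lcomp K W (W : Submodule K M).subtype with
        map_lie' := fun {x f} => by ext w; simp [LieHom.lie_apply]; rfl }
    have hf₀' : f₀ ∈ maxTrivSubmodule K L (M →ₗ[K] W) ⊔
        ⁅(⊤ : LieIdeal K L), (⊤ : LieSubmodule K L (M →ₗ[K] W))⁆ := by
      rw [(isCompl_maxTrivSubmodule_lie_top K L (M →ₗ[K] W)).sup_eq_top]; trivial
    obtain ⟨p, hp, q, hq, hpq⟩ := (LieSubmodule.mem_sup _ _ _).mp hf₀'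
    have hid : r p + r q = LinearMap.id := by rw [← map_add, hpq]; exact hf₀
    have h1 : r q ∈ maxTrivSubmodule K L (W →ₗ[K] W) := fun x => by
      have hp' : ⁅x, r p⁆ = 0 := by rw [← LieModuleHom.map_lie r, hp x, map_zero]
      rw [eq_sub_of_add_eq' hid, lie_sub, hp', sub_zero]
      ext w
      simp [LieHom.lie_apply]
    have h2 : r q ∈ ⁅(⊤ : LieIdeal K L), (⊤ : LieSubmodule K L (W →ₗ[K] W))⁆ := by
      have := LieSubmodule.mem_map_of_mem (f := r) hq
      rw [LieSubmodule.map_bracket_eq] at this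
      have hle := LieSubmodule.mono_lie_right (⊤ : LieIdeal K L)
        (le_top : (⊤ : LieSubmodule K L (M →ₗ[K] W)).map r ≤ ⊤)
      exact hle this
    have h3 : r q = 0 := by
      have : r q ∈ maxTrivSubmodule K L (W →ₗ[K] W) ⊓
        ⁅(⊤ : LieIdeal K L), (⊤ : LieSubmodule K L (W →ₗ[K] W))⁆ := ⟨h1, h2⟩
      rwa [(isCompl_maxTrivSubmodule_lie_top K L (W →ₗ[K] W)).inf_eq_bot] at this
    rw [h3, add_zero] at hid
    exact ⟨p, hp, fun w => LinearMap.congr_fun hid w⟩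
  obtain ⟨f, hf, hfW⟩ := key
  have hf' (x : L) (m : M) : f ⁅x, m⁆ = ⁅x, f m⁆ := by
    have := LinearMap.congr_fun (hf x) m
    rw [LieHom.lie_apply, LinearMap.zero_apply, sub_eq_zero] at this
    exact this.symm
  let g : M →ₗ⁅K,L⁆ W := { f with map_lie' := hf' _ _ }
  refine ⟨g.ker, ?_⟩
  rw [← LieSubmodule.isCompl_toSubmodule]
  have : LinearMap.ker f = (g.ker : Submodule K M) := rfl
  rw [← this]
  exact LinearMap.isCompl_of_proj hfW

end Weyl
end LieModule

/-! ### Submodules of highest weight modules -/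

namespace HighestWeight

open LieAlgebra LieAlgebra.IsKilling

variable {𝔤 : Type*} [LieRing 𝔤] [LieAlgebra ℂ 𝔤]

/-- `U(𝔤)` is generated by `𝔤` as an algebra. -/
lemma adjoin_range_ι_eq_top :
    Algebra.adjoin ℂ (Set.range (UniversalEnvelopingAlgebra.ι ℂ : 𝔤 → _)) = ⊤ := by
  let : LieRing (UniversalEnvelopingAlgebra ℂ 𝔤) := LieRing.ofAssociativeRing
  set S := Algebra.adjoin ℂ (Set.range (UniversalEnvelopingAlgebra.ι ℂ : 𝔤 → _)) with hS
  let : LieRing S := LieRing.ofAssociativeRing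
  let j : 𝔤 →ₗ⁅ℂ⁆ S :=
    { toFun := fun x => ⟨UniversalEnvelopingAlgebra.ι ℂ x, Algebra.subset_adjoin ⟨x, rfl⟩⟩
      map_add' := fun x y => Subtype.ext (map_add _ x y)
      map_smul' := fun c x => Subtype.ext (map_smul _ c x)
      map_lie' := fun {x y} => Subtype.ext (LieHom.map_lie (UniversalEnvelopingAlgebra.ι ℂ) x y) }
  have h : S.val.comp (UniversalEnvelopingAlgebra.lift ℂ j) = AlgHom.id ℂ _ := by
    refine UniversalEnvelopingAlgebra.hom_ext ℂ ?_
    ext x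
    simp [j]
  rw [eq_top_iff]
  intro u _
  have := AlgHom.congr_fun h u
  rw [AlgHom.comp_apply, AlgHom.id_apply] at this
  rw [← this]
  exact (UniversalEnvelopingAlgebra.lift ℂ j u).2

variable {V : Type*} [AddCommGroup V] [Module (UniversalEnvelopingAlgebra ℂ 𝔤) V]

lemma ι_smul_ι_smul (x y : 𝔤) (v : V) :
    UniversalEnvelopingAlgebra.ι ℂ x • UniversalEnvelopingAlgebra.ι ℂ y • v =
      UniversalEnvelopingAlgebra.ι ℂ ⁅x, y⁆ • v +
        UniversalEnvelopingAlgebra.ι ℂ y • UniversalEnvelopingAlgebra.ι ℂ x • v := by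
  let : LieRing (UniversalEnvelopingAlgebra ℂ 𝔤) := LieRing.ofAssociativeRing
  have h : UniversalEnvelopingAlgebra.ι ℂ ⁅x, y⁆ =
      UniversalEnvelopingAlgebra.ι ℂ x * UniversalEnvelopingAlgebra.ι ℂ y -
        UniversalEnvelopingAlgebra.ι ℂ y * UniversalEnvelopingAlgebra.ι ℂ x :=
    LieHom.map_lie (UniversalEnvelopingAlgebra.ι ℂ) x y
  rw [h, sub_smul, mul_smul, mul_smul]
  abel

variable [Module ℂ V] [IsScalarTower ℂ (UniversalEnvelopingAlgebra ℂ 𝔤) V]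

/-- A subspace stable under `𝔤` is stable under `U(𝔤)`. -/
lemma smul_mem_of_forall_ι_smul_mem {P : Submodule ℂ V}
    (h : ∀ x : 𝔤, ∀ v ∈ P, UniversalEnvelopingAlgebra.ι ℂ x • v ∈ P)
    (u : UniversalEnvelopingAlgebra ℂ 𝔤) {v : V} (hv : v ∈ P) : u • v ∈ P := by
  have hu : u ∈ Algebra.adjoin ℂ (Set.range (UniversalEnvelopingAlgebra.ι ℂ : 𝔤 → _)) := by
    rw [adjoin_range_ι_eq_top]; trivial
  induction hu using Algebra.adjoin_induction generalizing v with
  | mem x hx => obtain ⟨x, rfl⟩ := hx; exact h x v hv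
  | algebraMap c => rw [algebraMap_smul]; exact P.smul_mem c hv
  | add x y _ _ hx hy => rw [add_smul]; exact add_mem (hx hv) (hy hv)
  | mul x y _ _ hx hy => rw [mul_smul]; exact hx (hy hv)

variable [FiniteDimensional ℂ 𝔤] [LieAlgebra.IsKilling ℂ 𝔤]
  {H : LieSubalgebra ℂ 𝔤} [H.IsCartanSubalgebra] (b : (rootSystem H).Base)

/-- There is an element of the Cartan subalgebra on which each root takes its height as value. -/
lemma exists_forall_root_eq_height : ∃ h₀ : H, ∀ α : H.root, α.1 h₀ = (b.height α : ℂ) := by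
  let f : Module.Dual ℂ (Module.Dual ℂ H) := b.toWeightBasis.constr ℂ fun _ => (1 : ℂ)
  refine ⟨(Module.evalEquiv ℂ H).symm f, fun α => ?_⟩
  have h1 : α.1 ((Module.evalEquiv ℂ H).symm f) = f ((rootSystem H).root α) :=
    Module.apply_evalEquiv_symm_apply ℂ H ((rootSystem H).root α) f
  have hf (i) (hi : i ∈ b.support) : f ((rootSystem H).root i) = 1 := by
    have := b.toWeightBasis.constr_basis ℂ (fun _ => (1 : ℂ)) ⟨i, hi⟩
    rwa [b.toWeightBasis_apply] at this
  obtain ⟨c, -, -, hc⟩ := b.exists_root_eq_sum_int α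
  rw [h1, RootPairing.Base.height_eq_sum hc, hc, map_sum]
  push_cast
  refine Finset.sum_congr rfl fun i hi => ?_
  rw [map_zsmul, hf i hi]
  simp

/-- Triangular decomposition of `𝔤`. -/
lemma mem_of_triangular {P : Submodule ℂ 𝔤} (hH : ∀ h : H, (h : 𝔤) ∈ P)
    (hpos : ∀ α : H.root, b.IsPos α → ∀ e ∈ rootSpace H α.1, e ∈ P)
    (hneg : ∀ α : H.root, ¬ b.IsPos α → ∀ e ∈ rootSpace H α.1, e ∈ P) (x : 𝔤) : x ∈ P := by
  have h := LieModule.iSup_genWeightSpace_eq_top' ℂ H 𝔤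
  have hx : x ∈ (⨆ χ : LieModule.Weight ℂ H 𝔤, LieModule.genWeightSpace 𝔤 χ).toSubmodule := by
    rw [h]; trivial
  rw [LieSubmodule.iSup_toSubmodule] at hx
  refine (iSup_le fun χ => ?_ : _ ≤ P) hx
  intro e he
  by_cases h0 : χ.IsZero
  · have he' : e ∈ zeroRootSubalgebra ℂ 𝔤 H := by
      have : e ∈ LieModule.genWeightSpace 𝔤 (χ : H → ℂ) := he
      rwa [h0.eq] at this
    rw [zeroRootSubalgebra_eq_of_is_cartan] at he'
    exact hH ⟨e, he'⟩
  · have hχ : χ ∈ H.root := by simpa using h0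
    by_cases hp : b.IsPos ⟨χ, hχ⟩
    · exact hpos ⟨χ, hχ⟩ hp e he
    · exact hneg ⟨χ, hχ⟩ hp e he

variable (lam : Module.Dual ℂ H)

/-- `v` is obtained from `v₀` by applying successively root vectors of negative roots whose
heights add up to `-n`. -/
inductive IsLoweringMonomial (v₀ : V) : ℕ → V → Prop
  | base : IsLoweringMonomial v₀ 0 v₀
  | step {n : ℕ} {v : V} (α : H.root) (f : 𝔤) : IsLoweringMonomial v₀ n v → ¬ b.IsPos α →
      f ∈ rootSpace H α.1 → IsLoweringMonomial v₀ (n + (b.height α).natAbs)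
        (UniversalEnvelopingAlgebra.ι ℂ f • v)

/-- `v₀` is a vector of weight `lam` killed by all positive root vectors. -/
structure IsHighestWeightVector (v₀ : V) : Prop where
  ι_smul_of_cartan (h : H) : UniversalEnvelopingAlgebra.ι ℂ (h : 𝔤) • v₀ = lam h • v₀
  ι_smul_of_isPos (α : H.root) (hα : b.IsPos α) (e : 𝔤) (he : e ∈ rootSpace H α.1) :
    UniversalEnvelopingAlgebra.ι ℂ e • v₀ = 0

variable {b lam}

lemma IsLoweringMonomial.ι_smul_eq {h₀ : H} (hh₀ : ∀ α : H.root, α.1 h₀ = (b.height α : ℂ))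
    {v₀ : V} (hv₀ : IsHighestWeightVector b lam v₀) {n : ℕ} {v : V}
    (hv : IsLoweringMonomial b v₀ n v) :
    UniversalEnvelopingAlgebra.ι ℂ (h₀ : 𝔤) • v = (lam h₀ - n) • v := by
  induction hv with
  | base => simpa using hv₀.ι_smul_of_cartan h₀
  | @step n v α f _ hα hf ih =>
    have hb : ⁅(h₀ : 𝔤), f⁆ = (b.height α : ℂ) • f := by
      rw [← hh₀ α]; exact lie_eq_smul_of_mem_rootSpace hf h₀
    have hn : ((b.height α).natAbs : ℂ) = -(b.height α : ℂ) := by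
      have h1 : b.height α < 0 := by
        rw [RootPairing.Base.isPos_iff'] at hα
        exact not_le.mp hα
      rw [← Int.cast_natCast, Int.natCast_natAbs, abs_of_neg h1]
      push_cast; rfl
    rw [ι_smul_ι_smul, ih, hb, map_smul, smul_assoc, smul_algebra_smul_comm, ← add_smul]
    push_cast
    rw [hn]
    congr 1
    ring

/-- The module generated by a highest weight vector is spanned by the lowering monomials. -/
lemma IsHighestWeightVector.span_isLoweringMonomial_eq_top {v₀ : V}
    (hv₀ : IsHighestWeightVector b lam v₀)
    (hgen : Submodule.span (UniversalEnvelopingAlgebra ℂ 𝔤) {v₀} = ⊤) :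
    Submodule.span ℂ {v : V | ∃ n, IsLoweringMonomial b v₀ n v} = ⊤ := by
  set P := Submodule.span ℂ {v : V | ∃ n, IsLoweringMonomial b v₀ n v} with hP
  have hv₀P : v₀ ∈ P := Submodule.subset_span ⟨0, .base⟩
  have hlow (α : H.root) (hα : ¬ b.IsPos α) (f : 𝔤) (hf : f ∈ rootSpace H α.1) (v : V)
      (hv : v ∈ P) : UniversalEnvelopingAlgebra.ι ℂ f • v ∈ P := by
    induction hv using Submodule.span_induction with
    | mem v hv => obtain ⟨n, hv⟩ := hv; exact Submodule.subset_span ⟨_, hv.step α f hα hf⟩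
    | zero => simp
    | add v w _ _ hv hw => rw [smul_add]; exact add_mem hv hw
    | smul c v _ hv => rw [smul_algebra_smul_comm]; exact P.smul_mem c hv
  have hmon (n : ℕ) (v : V) (hv : IsLoweringMonomial b v₀ n v) (x : 𝔤) :
      UniversalEnvelopingAlgebra.ι ℂ x • v ∈ P := by
    induction hv generalizing x with
    | base =>
      let Q : Submodule ℂ 𝔤 :=
        { carrier := {x | UniversalEnvelopingAlgebra.ι ℂ x • v₀ ∈ P}
          add_mem' := fun {x y} hx hy => by
            rw [Set.mem_ofPred_eq, map_add, add_smul]; exact add_mem hx hy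
          zero_mem' := by simp
          smul_mem' := fun c x hx => by
            rw [Set.mem_ofPred_eq, map_smul, smul_assoc]; exact P.smul_mem c hx }
      refine mem_of_triangular b (P := Q) (fun h => ?_) (fun α hα e he => ?_)
        (fun α hα f hf => ?_) x
      · change UniversalEnvelopingAlgebra.ι ℂ (h : 𝔤) • v₀ ∈ P
        rw [hv₀.ι_smul_of_cartan]; exact P.smul_mem _ hv₀P
      · change UniversalEnvelopingAlgebra.ι ℂ e • v₀ ∈ P
        rw [hv₀.ι_smul_of_isPos α hα e he]; exact P.zero_mem
      · exact hlow α hα f hf v₀ hv₀P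
    | @step n v α f _ hα hf ih =>
      rw [ι_smul_ι_smul]
      exact add_mem (ih _) (hlow α hα f hf _ (ih x))
  have hstab (x : 𝔤) (v : V) (hv : v ∈ P) : UniversalEnvelopingAlgebra.ι ℂ x • v ∈ P := by
    induction hv using Submodule.span_induction with
    | mem v hv => obtain ⟨n, hv⟩ := hv; exact hmon n v hv x
    | zero => simp
    | add v w _ _ hv hw => rw [smul_add]; exact add_mem hv hw
    | smul c v _ hv => rw [smul_algebra_smul_comm]; exact P.smul_mem c hv
  rw [eq_top_iff]
  intro v _
  have hv : v ∈ Submodule.span (UniversalEnvelopingAlgebra ℂ 𝔤) {v₀} := by rw [hgen]; trivial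
  obtain ⟨u, rfl⟩ := Submodule.mem_span_singleton.mp hv
  exact smul_mem_of_forall_ι_smul_mem hstab u hv₀P

variable (b) in
/-- The span of the lowering monomials of positive degree. -/
def lowerPart (v₀ : V) : Submodule ℂ V :=
  Submodule.span ℂ {v | ∃ n, 0 < n ∧ IsLoweringMonomial b v₀ n v}

open Polynomial in
/-- The lower part is a sum of eigenspaces of `h₀` for eigenvalues other than `lam h₀`. -/
lemma IsHighestWeightVector.exists_aeval_smul_eq_zero {h₀ : H}
    (hh₀ : ∀ α : H.root, α.1 h₀ = (b.height α : ℂ)) {v₀ : V}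
    (hv₀ : IsHighestWeightVector b lam v₀) {v : V} (hv : v ∈ lowerPart b v₀) :
    ∃ p : ℂ[X], aeval (UniversalEnvelopingAlgebra.ι ℂ (h₀ : 𝔤)) p • v = 0 ∧
      p.eval (lam h₀) ≠ 0 := by
  induction hv using Submodule.span_induction with
  | mem v hv =>
    obtain ⟨n, hn, hv⟩ := hv
    refine ⟨X - C (lam h₀ - n), ?_, by simpa using hn.ne'⟩
    rw [map_sub, aeval_X, aeval_C, sub_smul, algebraMap_smul, hv.ι_smul_eq hh₀ hv₀, sub_self]
  | zero => exact ⟨1, by simp, by simp⟩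
  | add v w _ _ hv hw =>
    obtain ⟨p, hp, hp'⟩ := hv
    obtain ⟨q, hq, hq'⟩ := hw
    refine ⟨p * q, ?_, by simp [hp', hq']⟩
    have hv : aeval (UniversalEnvelopingAlgebra.ι ℂ (h₀ : 𝔤)) (p * q) • v = 0 := by
      rw [mul_comm, map_mul, mul_smul, hp, smul_zero]
    rw [smul_add, hv, map_mul, mul_smul, hq, smul_zero, add_zero]
  | smul c v _ hv =>
    obtain ⟨p, hp, hp'⟩ := hv
    exact ⟨p, by rw [smul_algebra_smul_comm, hp, smul_zero], hp'⟩

open Polynomial in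
lemma IsHighestWeightVector.aeval_smul (h₀ : H) {v₀ : V}
    (hv₀ : IsHighestWeightVector b lam v₀) (p : ℂ[X]) :
    aeval (UniversalEnvelopingAlgebra.ι ℂ (h₀ : 𝔤)) p • v₀ = p.eval (lam h₀) • v₀ := by
  induction p using Polynomial.induction_on' with
  | add p q hp hq => rw [map_add, add_smul, hp, hq, eval_add, add_smul]
  | monomial n c =>
    have h (n : ℕ) : UniversalEnvelopingAlgebra.ι ℂ (h₀ : 𝔤) ^ n • v₀ = lam h₀ ^ n • v₀ := by
      induction n with
      | zero => simp
      | succ n ih =>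
        rw [pow_succ, mul_smul, hv₀.ι_smul_of_cartan, smul_algebra_smul_comm, ih, smul_smul,
          pow_succ']
    rw [aeval_monomial, eval_monomial, mul_smul, algebraMap_smul, h, mul_smul]

lemma IsHighestWeightVector.notMem_lowerPart {v₀ : V} (hv₀ : IsHighestWeightVector b lam v₀)
    (hne : v₀ ≠ 0) : v₀ ∉ lowerPart b v₀ := by
  intro hmem
  obtain ⟨h₀, hh₀⟩ := exists_forall_root_eq_height b
  obtain ⟨p, hp, hp'⟩ := hv₀.exists_aeval_smul_eq_zero hh₀ hmem
  rw [hv₀.aeval_smul] at hp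
  exact (smul_ne_zero hp' hne) hp

/-- Every proper submodule of a highest weight module avoids the highest weight space: otherwise
a polynomial in a regular Cartan element would project one of its vectors to the generator. -/
lemma IsHighestWeightVector.mem_lowerPart_of_ne_top {v₀ : V}
    (hv₀ : IsHighestWeightVector b lam v₀)
    (hgen : Submodule.span (UniversalEnvelopingAlgebra ℂ 𝔤) {v₀} = ⊤)
    {W : Submodule (UniversalEnvelopingAlgebra ℂ 𝔤) V} (hW : W ≠ ⊤) {w : V} (hw : w ∈ W) :
    w ∈ lowerPart b v₀ := by
  obtain ⟨h₀, hh₀⟩ := exists_forall_root_eq_height b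
  have hsplit : w ∈ Submodule.span ℂ {v₀} ⊔ lowerPart b v₀ := by
    have hle : Submodule.span ℂ {v : V | ∃ n, IsLoweringMonomial b v₀ n v} ≤
        Submodule.span ℂ {v₀} ⊔ lowerPart b v₀ := by
      refine Submodule.span_le.mpr ?_
      rintro v ⟨n, hv⟩
      cases hv with
      | base => exact Submodule.mem_sup_left (Submodule.mem_span_singleton_self v₀)
      | step α f hv hα hf =>
        refine Submodule.mem_sup_right (Submodule.subset_span ⟨_, ?_, hv.step α f hα hf⟩)
        have := b.height_ne_zero α
        lia
    exact hle (by rw [hv₀.span_isLoweringMonomial_eq_top hgen]; trivial)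
  obtain ⟨y, hy, t, ht, rfl⟩ := Submodule.mem_sup.mp hsplit
  obtain ⟨c, rfl⟩ := Submodule.mem_span_singleton.mp hy
  obtain ⟨p, hp, hp'⟩ := hv₀.exists_aeval_smul_eq_zero hh₀ ht
  by_cases hc : c = 0
  · simpa [hc] using ht
  · refine absurd (eq_top_iff.mpr ?_) hW
    rw [← hgen, Submodule.span_singleton_le_iff_mem]
    have h1 := W.smul_mem (Polynomial.aeval (UniversalEnvelopingAlgebra.ι ℂ (h₀ : 𝔤)) p) hw
    rw [smul_add, hp, add_zero, smul_algebra_smul_comm, hv₀.aeval_smul, smul_smul] at h1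
    have h2 := W.smul_of_tower_mem (c * p.eval (lam h₀))⁻¹ h1
    rwa [inv_smul_smul₀ (mul_ne_zero hc hp')] at h2

/-- A maximal submodule of a highest weight module contains every proper submodule. -/
lemma IsHighestWeightVector.le_of_isCoatom {v₀ : V} (hv₀ : IsHighestWeightVector b lam v₀)
    (hne : v₀ ≠ 0) (hgen : Submodule.span (UniversalEnvelopingAlgebra ℂ 𝔤) {v₀} = ⊤)
    {W K : Submodule (UniversalEnvelopingAlgebra ℂ 𝔤) V} (hK : IsCoatom K) (hW : W ≠ ⊤) :
    W ≤ K := by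
  by_contra hWK
  have hsup : W ⊔ K = ⊤ := hK.2 _ (right_lt_sup.mpr hWK)
  have hv : v₀ ∈ W ⊔ K := by rw [hsup]; trivial
  obtain ⟨w, hw, k, hk, hwk⟩ := Submodule.mem_sup.mp hv
  refine hv₀.notMem_lowerPart hne ?_
  have := add_mem (hv₀.mem_lowerPart_of_ne_top hgen hW hw)
    (hv₀.mem_lowerPart_of_ne_top hgen hK.1 hk)
  rwa [hwk] at this

end HighestWeight

/-! ### The theorem of the highest weight -/

namespace HighestWeight

open LieAlgebra LieAlgebra.IsKilling

variable {𝔤 : Type*} [LieRing 𝔤] [LieAlgebra ℂ 𝔤] [FiniteDimensional ℂ 𝔤]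
  [LieAlgebra.IsKilling ℂ 𝔤] {H : LieSubalgebra ℂ 𝔤} [H.IsCartanSubalgebra]
  (b : (rootSystem H).Base)

section Module

variable (M : Type*) [AddCommGroup M] [Module ℂ M] [LieRingModule 𝔤 M] [LieModule ℂ 𝔤 M]

/-- A weight whose value at the height element has maximal real part is a highest weight. -/
lemma exists_highestWeight [FiniteDimensional ℂ M] [Nontrivial M] :
    ∃ (lam : Module.Dual ℂ H) (m : M), m ≠ 0 ∧ (∀ h : H, ⁅(h : 𝔤), m⁆ = lam h • m) ∧
    ∀ α : H.root, b.IsPos α → ∀ e ∈ rootSpace H α.1, ⁅e, m⁆ = 0 := by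
  obtain ⟨h₀, hh₀⟩ := exists_forall_root_eq_height b
  have hne : Nonempty (LieModule.Weight ℂ H M) := by
    by_contra! contra
    simpa only [iSup_of_empty, bot_ne_top] using LieModule.iSup_genWeightSpace_eq_top' ℂ H M
  obtain ⟨χ, hχ⟩ := Finite.exists_max fun χ : LieModule.Weight ℂ H M => (χ h₀).re
  obtain ⟨m, hm, hm'⟩ := LieModule.exists_forall_lie_eq_smul ℂ H M χ
  refine ⟨χ.toLinear, m, hm, hm', fun α hα e he => ?_⟩
  by_contra hem
  have hw (h : H) : ⁅h, ⁅e, m⁆⁆ = (χ h + α.1 h) • ⁅e, m⁆ := by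
    have h1 : ⁅(h : 𝔤), e⁆ = α.1 h • e := lie_eq_smul_of_mem_rootSpace he h
    have h2 : ⁅(h : 𝔤), m⁆ = χ h • m := hm' h
    change ⁅(h : 𝔤), ⁅e, m⁆⁆ = _
    rw [leibniz_lie, h1, h2, lie_smul, smul_lie, ← add_smul, add_comm]
  have hmem : ⁅e, m⁆ ∈ LieModule.genWeightSpace M (fun h => χ h + α.1 h) :=
    LieModule.weightSpace_le_genWeightSpace M _ ((LieModule.mem_weightSpace _ _).mpr hw)
  have := hχ ⟨fun h => χ h + α.1 h, fun h => hem (by rwa [h] at hmem)⟩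
  change (χ h₀ + α.1 h₀).re ≤ (χ h₀).re at this
  rw [hh₀ α, Complex.add_re, Complex.intCast_re, add_le_iff_nonpos_right] at this
  exact absurd (Int.cast_nonpos.mp this) (not_le.mpr hα)

variable {M} in
/-- By the representation theory of `sl₂`, highest weights of finite-dimensional modules are
dominant integral. -/
lemma isDominantIntegral_of_highestWeight [FiniteDimensional ℂ M] {lam : Module.Dual ℂ H} {m : M}
    (hm : m ≠ 0) (hH : ∀ h : H, ⁅(h : 𝔤), m⁆ = lam h • m)
    (hpos : ∀ α : H.root, b.IsPos α → ∀ e ∈ rootSpace H α.1, ⁅e, m⁆ = 0) :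
    IsDominantIntegral b lam := by
  intro α hα
  have hα0 : α.1.IsNonZero := H.isNonZero_coe_root α
  obtain ⟨h, e, f, t, he, hf⟩ := exists_isSl2Triple_of_weight_isNonZero hα0
  have hh := t.h_eq_coroot hα0 he hf
  have P : t.HasPrimitiveVectorWith m (lam (coroot α.1)) :=
    ⟨hm, by rw [hh]; exact hH _, hpos α hα e he⟩
  exact P.exists_nat

variable {M} in
/-- An irreducible module with a vector of highest weight `lam` is isomorphic to `L(lam)`. -/
lemma nonempty_lieModuleEquiv_irr [LieModule.IsIrreducible ℂ 𝔤 M] {lam : Module.Dual ℂ H} {m : M}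
    (hm : m ≠ 0) (hH : ∀ h : H, ⁅(h : 𝔤), m⁆ = lam h • m)
    (hpos : ∀ α : H.root, b.IsPos α → ∀ e ∈ rootSpace H α.1, ⁅e, m⁆ = 0) :
    Nonempty (M ≃ₗ⁅ℂ,𝔤⁆ Irr b lam) := by
  let U := UniversalEnvelopingAlgebra ℂ 𝔤
  let ρ : U →ₐ[ℂ] Module.End ℂ M := UniversalEnvelopingAlgebra.lift ℂ (LieModule.toEnd ℂ 𝔤 M)
  let _ : Module U M := Module.compHom M ρ.toRingHom
  have hι (x : 𝔤) (n : M) : UniversalEnvelopingAlgebra.ι ℂ x • n = ⁅x, n⁆ := by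
    change ρ (UniversalEnvelopingAlgebra.ι ℂ x) n = ⁅x, n⁆
    rw [UniversalEnvelopingAlgebra.lift_ι_apply]
    rfl
  have halg (c : ℂ) (n : M) : algebraMap ℂ U c • n = c • n := by
    change ρ (algebraMap ℂ U c) n = c • n
    rw [AlgHom.commutes]
    rfl
  have hsimple : IsSimpleModule U M := by
    have hnt : Nontrivial M := LieModule.nontrivial_of_isIrreducible ℂ 𝔤 M
    rw [isSimpleModule_iff]
    refine IsSimpleOrder.of_forall_eq_top fun W hW => ?_
    let W' : LieSubmodule ℂ 𝔤 M :=
      { carrier := W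
        add_mem' := W.add_mem
        zero_mem' := W.zero_mem
        smul_mem' := fun c n hn => by rw [← halg]; exact W.smul_mem _ hn
        lie_mem := fun {x n} hn => by rw [← hι]; exact W.smul_mem _ hn }
    rcases IsSimpleOrder.eq_bot_or_eq_top W' with h | h
    · refine absurd ((Submodule.eq_bot_iff _).mpr fun n hn => ?_) hW
      have hn' : n ∈ W' := hn
      rwa [h] at hn'
    · refine eq_top_iff.mpr fun n _ => ?_
      have hn : n ∈ W' := by rw [h]; trivial
      exact hn
  have hker : vermaIdeal b lam ≤ LinearMap.ker (LinearMap.toSpanSingleton U M m) := by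
    refine Submodule.span_le.mpr ?_
    rintro u (⟨α, hα, e, he, rfl⟩ | ⟨h, rfl⟩)
    · change UniversalEnvelopingAlgebra.ι ℂ e • m = 0
      rw [hι]
      exact hpos α hα e he
    · change (UniversalEnvelopingAlgebra.ι ℂ (h : 𝔤) - algebraMap ℂ U (lam h)) • m = 0
      rw [sub_smul, hι, halg, hH, sub_self]
  let F : Verma b lam →ₗ[U] M := (vermaIdeal b lam).liftQ (LinearMap.toSpanSingleton U M m) hker
  let v₀ : Verma b lam := (vermaIdeal b lam).mkQ 1
  have hFv₀ : F v₀ = m := by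
    change (1 : U) • m = m
    exact one_smul _ _
  have hv₀ : IsHighestWeightVector b lam v₀ := by
    constructor
    · intro h
      change (vermaIdeal b lam).mkQ _ = (vermaIdeal b lam).mkQ _
      rw [← sub_eq_zero, ← map_sub, Submodule.mkQ_apply, Submodule.Quotient.mk_eq_zero]
      refine Submodule.subset_span (Or.inr ⟨h, ?_⟩)
      change UniversalEnvelopingAlgebra.ι ℂ (h : 𝔤) * 1 - lam h • (1 : U) = _
      rw [mul_one, Algebra.algebraMap_eq_smul_one]
    · intro α hα e he
      change (vermaIdeal b lam).mkQ _ = 0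
      rw [Submodule.mkQ_apply, Submodule.Quotient.mk_eq_zero]
      exact Submodule.subset_span (Or.inl ⟨α, hα, e, he, mul_one _⟩)
  have hgen : Submodule.span U {v₀} = ⊤ := by
    rw [eq_top_iff]
    intro v _
    obtain ⟨u, rfl⟩ := (vermaIdeal b lam).mkQ_surjective v
    rw [Submodule.mem_span_singleton]
    exact ⟨u, by rw [← map_smul, smul_eq_mul, mul_one]⟩
  have hv₀ne : v₀ ≠ 0 := fun h => hm (by rw [← hFv₀, h, map_zero])
  have hFsurj : Function.Surjective F := by
    rw [← LinearMap.range_eq_top]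
    refine (IsSimpleOrder.eq_bot_or_eq_top _).resolve_left fun h => hm ?_
    have : F v₀ ∈ LinearMap.range F := ⟨v₀, rfl⟩
    rw [h, hFv₀] at this
    exact this
  have hcoatom : IsCoatom (LinearMap.ker F) := LinearMap.isCoatom_ker_of_surjective hFsurj
  have hmax : LinearMap.ker F = vermaMaximal b lam :=
    le_antisymm (le_sSup hcoatom.1)
      (sSup_le fun W hW => hv₀.le_of_isCoatom hv₀ne hgen hcoatom hW)
  let e : Irr b lam ≃ₗ[U] M :=
    (Submodule.quotEquivOfEq _ _ hmax).symm.trans (F.quotKerEquivOfSurjective hFsurj)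
  refine ⟨LieModuleEquiv.symm
    { toFun := e
      map_add' := map_add e
      map_smul' := fun c v => ?_
      map_lie' := fun {x v} => ?_
      invFun := e.symm
      left_inv := e.left_inv
      right_inv := e.right_inv }⟩
  · exact (map_smul e (algebraMap ℂ U c) v).trans (halg c _)
  · exact (map_smul e (UniversalEnvelopingAlgebra.ι ℂ x) v).trans (hι x _)

/-- The theorem of the highest weight: irreducible modules are the `L(lam)`, `lam` dominant
integral. -/
theorem exists_isDominantIntegral_nonempty_equiv [FiniteDimensional ℂ M]
    [LieModule.IsIrreducible ℂ 𝔤 M] :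
    ∃ lam : Module.Dual ℂ H, IsDominantIntegral b lam ∧ Nonempty (M ≃ₗ⁅ℂ,𝔤⁆ Irr b lam) := by
  have hnt : Nontrivial M := LieModule.nontrivial_of_isIrreducible ℂ 𝔤 M
  obtain ⟨lam, m, hm, hH, hpos⟩ := exists_highestWeight b M
  exact ⟨lam, isDominantIntegral_of_highestWeight b hm hH hpos,
    nonempty_lieModuleEquiv_irr b hm hH hpos⟩

end Module

end HighestWeight

/-! ### Modules on which anticommutators act by scalars -/

namespace LieModule

open LinearMap (BilinForm)

section Anticommutator

variable {K L M : Type*} [Field K] [CharZero K] [LieRing L] [LieAlgebra K L]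
  [FiniteDimensional K L] [LieAlgebra.IsSimple K L]
  [AddCommGroup M] [Module K M] [LieRingModule L M] [LieModule K L M]

/-- The Casimir operator of the trace form of an irreducible module `M` is injective, its trace
being `dim L`. -/
lemma casimir_traceForm_injective [IsIrreducible K L M] {ι : Type*} [Fintype ι] [DecidableEq ι]
    (b : Module.Basis ι K L) (hB : (traceForm K L M).Nondegenerate) :
    Function.Injective (casimir hB b M) := by
  have hs : (traceForm K L M).IsSymm := ⟨fun x y => traceForm_comm K L M x y⟩
  let g : M →ₗ⁅K,L⁆ M := { casimir hB b M with
    map_lie' := casimir_lie hB hs b M (traceForm_lieInvariant K L M) _ _ }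
  rcases IsSimpleOrder.eq_bot_or_eq_top g.ker with h | h
  · rw [← LinearMap.ker_eq_bot]
    exact congrArg LieSubmodule.toSubmodule h
  · have h0 : casimir hB b M = 0 := LinearMap.ker_eq_top.mp (congrArg LieSubmodule.toSubmodule h)
    have h1 := trace_casimir_traceForm b M hB
    rw [h0, map_zero, eq_comm, Nat.cast_eq_zero] at h1
    have := LieAlgebra.IsSimple.nontrivial K L
    exact absurd h1 Module.finrank_pos.ne'

variable (K) in
include K in
omit [CharZero K] [FiniteDimensional K L] in
lemma lie_eq_zero_of_forall_lie_lie_eq {m : M}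
    (h : ∀ x y : L, ⁅x, ⁅y, m⁆⁆ = ⁅y, ⁅x, m⁆⁆) (z : L) : ⁅z, m⁆ = 0 := by
  have hz : z ∈ Submodule.span K {z : L | ∃ x y : L, ⁅x, y⁆ = z} := by
    rw [span_lie_eq_top_of_isSimple]; trivial
  induction hz using Submodule.span_induction with
  | mem z hz => obtain ⟨x, y, rfl⟩ := hz; rw [lie_lie, h, sub_self]
  | zero => exact zero_lie m
  | add x y _ _ hx hy => rw [add_lie, hx, hy, add_zero]
  | smul c x _ hx => rw [smul_lie, hx, smul_zero]

/-- The difference `D u m = F u m - u m` satisfies `x (D y m) = y (D x m)`.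
Contracting with the canonical tensor of the trace form gives `C (D v m) = v (E m)` with `C` the
Casimir operator and `E = ∑ bᵢ D(bⁱ)`, whence `x y (E m) = y x (E m)`, so that `v (E m) = 0`. -/
lemma eq_lie_of_lie_eq_smul_sub [FiniteDimensional K M] [IsIrreducible K L M]
    (hM : ¬ IsTrivial L M) {φ : BilinForm K L}
    (hφ : φ.IsSymm) {F : L →ₗ[K] M →ₗ[K] M}
    (hF : ∀ (v u : L) (m : M), ⁅v, F u m⁆ = φ u v • m - ⁅u, ⁅v, m⁆⁆) (u : L) (m : M) :
    F u m = ⁅u, m⁆ := by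
  let b := Module.finBasis K L
  have hB := traceForm_nondegenerate_of_isSimple K L M hM
  have hs : (traceForm K L M).IsSymm := ⟨fun x y => traceForm_comm K L M x y⟩
  have hi := traceForm_lieInvariant K L M
  let D : L →ₗ[K] M →ₗ[K] M := F - (toEnd K L M : L →ₗ[K] Module.End K M)
  have hD (u : L) (m : M) : D u m = F u m - ⁅u, m⁆ := rfl
  have hsymm (x y : L) (m : M) : ⁅x, D y m⁆ = ⁅y, D x m⁆ := by
    rw [hD, hD, lie_sub, lie_sub, hF, hF, hφ.eq]
    abel
  let T (m : M) : L →ₗ[K] L →ₗ[K] M := LinearMap.mk₂ K (fun x y => ⁅x, D y m⁆)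
    (by simp) (by simp) (by simp) (by simp)
  let T' (m : M) (v : L) : L →ₗ[K] L →ₗ[K] M := LinearMap.mk₂ K (fun x y => ⁅x, D ⁅v, y⁆ m⁆)
    (by simp) (by simp) (by simp) (by simp)
  let E (m : M) : M := ∑ i, ⁅b i, D ((traceForm K L M).dualBasis hB b i) m⁆
  have hCD (v : L) (m : M) : casimir hB b M (D v m) = ⁅v, E m⁆ := by
    have h1 := sum_lie_dualBasis_add hB hs b hi (T m) v
    have h2 := sum_dualBasis_comm hB hs b (T' m v)
    simp only [T, T', LinearMap.mk₂_apply] at h1 h2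
    rw [Finset.sum_congr rfl fun i _ =>
      hsymm ((traceForm K L M).dualBasis hB b i) ⁅v, b i⁆ m] at h2
    rw [h2, ← two_smul K, smul_eq_zero_iff_right two_ne_zero] at h1
    rw [casimir_apply, ← sub_eq_zero, ← neg_sub, neg_eq_zero, ← h1, lie_sum,
      ← Finset.sum_sub_distrib]
    refine Finset.sum_congr rfl fun i _ => ?_
    rw [hsymm ((traceForm K L M).dualBasis hB b i) v m, lie_lie]
  have hE (v : L) (m : M) : ⁅v, E m⁆ = 0 := by
    refine lie_eq_zero_of_forall_lie_lie_eq K (fun x y => ?_) v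
    rw [← hCD, ← hCD, ← casimir_lie hB hs b M hi, ← casimir_lie hB hs b M hi, hsymm]
  have : D u m = 0 := casimir_traceForm_injective b hB (by rw [hCD, hE, map_zero])
  rwa [hD, sub_eq_zero] at this

end Anticommutator

end LieModule

namespace HighestWeight

open LieAlgebra LieAlgebra.IsKilling

variable {𝔤 M : Type*} [LieRing 𝔤] [LieAlgebra ℂ 𝔤]
  [AddCommGroup M] [Module ℂ M] [LieRingModule 𝔤 M] [LieModule ℂ 𝔤 M]
  {φ : LinearMap.BilinForm ℂ 𝔤}

/-- If `h, e, f` is an `sl₂`-triple then `h² = φ(h, h)/2` on `M` forces `h e m = e m`. -/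
lemma apply_eq_two_of_isSl2Triple
    (hφ : ∀ (x y : 𝔤) (m : M), ⁅x, ⁅y, m⁆⁆ + ⁅y, ⁅x, m⁆⁆ = φ x y • m)
    {h e f : 𝔤} (t : IsSl2Triple h e f) {m : M} (hm : ⁅e, m⁆ ≠ 0) : φ h h = 2 := by
  have hh (m : M) : ⁅h, ⁅h, m⁆⁆ = (φ h h / 2) • m := by
    have := hφ h h m
    rw [← two_smul ℂ] at this
    rw [div_eq_inv_mul, mul_smul, ← this, inv_smul_smul₀ two_ne_zero]
  have he (m : M) : ⁅h, ⁅e, m⁆⁆ = (2 : ℂ) • ⁅e, m⁆ + ⁅e, ⁅h, m⁆⁆ := by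
    rw [leibniz_lie, t.lie_h_e_smul ℂ, smul_lie]
  have h1 : ⁅e, ⁅h, m⁆⁆ = -⁅e, m⁆ := by
    have := hh ⁅e, m⁆
    rw [he, lie_add, lie_smul, he, he ⁅h, m⁆, hh, lie_smul] at this
    have h4 : (4 : ℂ) • (⁅e, ⁅h, m⁆⁆ + ⁅e, m⁆) = 0 := by
      rw [← sub_eq_zero] at this
      rw [← this]
      module
    exact eq_neg_of_add_eq_zero_left
      ((smul_eq_zero.mp h4).resolve_left (by norm_num : (4 : ℂ) ≠ 0))
  have h2 : ⁅h, ⁅e, m⁆⁆ = ⁅e, m⁆ := by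
    rw [he, h1, two_smul, add_neg_cancel_right]
  have h3 := hh ⁅e, m⁆
  rw [h2, h2] at h3
  have h4 : (φ h h / 2 - 1) • ⁅e, m⁆ = 0 := by rw [sub_smul, ← h3, one_smul, sub_self]
  have := (smul_eq_zero.mp h4).resolve_right hm
  linear_combination 2 * this

/-- A nonzero form describing the anticommutators of the action on a nontrivial module is the
normalized invariant form. -/
lemma isNormalizedInvariantForm_of_anticommutator [FiniteDimensional ℂ 𝔤]
    [LieAlgebra.IsSimple ℂ 𝔤]
    (hM : ¬ LieModule.IsTrivial 𝔤 M) (hs : φ.IsSymm) (hi : φ.lieInvariant 𝔤) (h0 : φ ≠ 0)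
    (hφ : ∀ (x y : 𝔤) (m : M), ⁅x, ⁅y, m⁆⁆ + ⁅y, ⁅x, m⁆⁆ = φ x y • m) :
    IsNormalizedInvariantForm φ where
  isSymm := hs
  nondegenerate := LieModule.nondegenerate_of_isSimple hs hi h0
  lieInvariant := hi
  -- The identity holds for every root, long or not.
  long_root H _ α _ := by
    have hα0 : α.1.IsNonZero := H.isNonZero_coe_root α
    obtain ⟨h, e, f, t, he, hf⟩ := exists_isSl2Triple_of_weight_isNonZero hα0
    have hh := t.h_eq_coroot hα0 he hf
    have hfaith : ∃ m : M, ⁅e, m⁆ ≠ 0 := by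
      by_contra! hcon
      have hker : e ∈ LieModule.ker ℂ 𝔤 M := (LieModule.mem_ker ℂ 𝔤 M e).mpr hcon
      rcases LieAlgebra.IsSimple.eq_bot_or_eq_top (LieModule.ker ℂ 𝔤 M) with hb | hb
      · rw [hb] at hker
        exact t.e_ne_zero hker
      · refine hM ⟨fun x m => (LieModule.mem_ker ℂ 𝔤 M x).mp ?_ m⟩
        rw [hb]; trivial
    obtain ⟨m, hm⟩ := hfaith
    have h2 : φ h h = 2 := apply_eq_two_of_isSl2Triple hφ t hm
    have hform (h' : H) : φ h h' = α.1 h' * φ f e := by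
      have h1 : ⁅(h' : 𝔤), e⁆ = α.1 h' • e := lie_eq_smul_of_mem_rootSpace he h'
      rw [← t.lie_e_f, hi, ← lie_skew, h1]
      simp
    have hfe : φ f e = 1 := by
      have h3 := hform (coroot α.1)
      rw [← hh, h2, root_apply_coroot hα0] at h3
      linear_combination -h3 / 2
    refine ⟨coroot α.1, fun h' => ?_, ?_⟩
    · rw [← hh, hform, hfe, mul_one]
    · rw [← hh, h2]

end HighestWeight

/-! ### Levi decomposition of simple Leibniz algebras -/

namespace LeibnizAlgebra

variable {L : Type*} [AddCommGroup L] [Module ℂ L] {𝔏 : LeibnizAlgebra L}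

lemma bracket_eq_zero_of_mem_leib {z : L} (hz : z ∈ 𝔏.leib) (v : L) : 𝔏.bracket z v = 0 := by
  induction hz using Submodule.span_induction with
  | mem z hz => obtain ⟨x, rfl⟩ := hz; simpa using 𝔏.leibniz x x v
  | zero => simp
  | add x y _ _ hx hy => rw [map_add, LinearMap.add_apply, hx, hy, add_zero]
  | smul c x _ hx => rw [map_smul, LinearMap.smul_apply, hx, smul_zero]

lemma bracket_self_mem_leib (x : L) : 𝔏.bracket x x ∈ 𝔏.leib := Submodule.subset_span ⟨x, rfl⟩

lemma bracket_add_bracket_mem_leib (x y : L) : 𝔏.bracket x y + 𝔏.bracket y x ∈ 𝔏.leib := by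
  have h : 𝔏.bracket x y + 𝔏.bracket y x =
      𝔏.bracket (x + y) (x + y) - 𝔏.bracket x x - 𝔏.bracket y y := by
    simp only [map_add, LinearMap.add_apply]; abel
  rw [h]
  exact sub_mem (sub_mem (bracket_self_mem_leib _) (bracket_self_mem_leib _))
    (bracket_self_mem_leib _)

lemma bracket_mem_leib (x : L) {z : L} (hz : z ∈ 𝔏.leib) : 𝔏.bracket x z ∈ 𝔏.leib := by
  have := 𝔏.bracket_add_bracket_mem_leib x z
  rwa [bracket_eq_zero_of_mem_leib hz, add_zero] at this

lemma leib_ne_bot (h : ¬ 𝔏.IsLie) : 𝔏.leib ≠ ⊥ := fun h0 =>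
  h fun x => by simpa [h0] using 𝔏.bracket_self_mem_leib x

namespace IsSimple

variable (hs : 𝔏.IsSimple) (hL : ¬ 𝔏.IsLie)
include hs hL

lemma ker_bracket_eq_leib : LinearMap.ker 𝔏.bracket = 𝔏.leib := by
  have hle : 𝔏.leib ≤ LinearMap.ker 𝔏.bracket := fun z hz =>
    LinearMap.ext fun v => bracket_eq_zero_of_mem_leib hz v
  have hideal : 𝔏.IsIdeal (LinearMap.ker 𝔏.bracket) := by
    intro x y hy
    replace hy : 𝔏.bracket y = 0 := hy
    refine ⟨LinearMap.ext fun z => ?_, ?_⟩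
    · have := 𝔏.leibniz x y z
      simp only [hy, LinearMap.zero_apply, map_zero, add_zero] at this
      exact this.symm
    · rw [hy]; exact Submodule.zero_mem _
  rcases hs.eq_of_isIdeal _ hideal with h | h | h
  · exact absurd (le_bot_iff.mp (h ▸ hle)) (leib_ne_bot hL)
  · exact h
  · refine absurd (fun x => ?_) hL
    have hx : x ∈ LinearMap.ker 𝔏.bracket := h ▸ trivial
    exact LinearMap.congr_fun hx x

/-- The Lie algebra `L / Leib(L)`, in any incarnation, is simple. -/
lemma isSimple_of_ker_eq_leib {S : Type*} [LieRing S] [LieAlgebra ℂ S] {p : L →ₗ[ℂ] S}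
    (hsurj : Function.Surjective p) (hp : ∀ x y, p (𝔏.bracket x y) = ⁅p x, p y⁆)
    (hker : LinearMap.ker p = 𝔏.leib) : LieAlgebra.IsSimple ℂ S where
  eq_bot_or_eq_top I := by
    have hideal : 𝔏.IsIdeal ((I : Submodule ℂ S).comap p) := by
      intro x y hy
      replace hy : p y ∈ I := hy
      refine ⟨?_, ?_⟩
      · change p _ ∈ I
        rw [hp]; exact lie_mem_right ℂ S I _ _ hy
      · change p _ ∈ I
        rw [hp]; exact lie_mem_left ℂ S I _ _ hy
    have hle : 𝔏.leib ≤ (I : Submodule ℂ S).comap p := by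
      rw [← hker]
      intro z hz
      change p z ∈ I
      rw [hz]; exact I.zero_mem
    rcases hs.eq_of_isIdeal _ hideal with h | h | h
    · exact absurd (le_bot_iff.mp (h ▸ hle)) (leib_ne_bot hL)
    · left
      rw [eq_bot_iff]
      intro s hsI
      obtain ⟨x, rfl⟩ := hsurj s
      have hx : x ∈ (I : Submodule ℂ S).comap p := hsI
      rw [h, ← hker] at hx
      exact hx
    · right
      rw [eq_top_iff]
      intro s _
      obtain ⟨x, rfl⟩ := hsurj s
      have hx : x ∈ (I : Submodule ℂ S).comap p := h ▸ trivial
      exact hx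
  non_abelian hab := by
    refine hs.derived_ne_leib (le_antisymm (Submodule.span_le.mpr ?_) (Submodule.span_mono ?_))
    · rintro _ ⟨x, y, rfl⟩
      rw [SetLike.mem_coe, ← hker, LinearMap.mem_ker, hp]
      exact hab.trivial _ _
    · rintro _ ⟨x, rfl⟩
      exact ⟨x, x, rfl⟩

lemma isSimple_of_isCompl {𝔤 : 𝔏.LieSub} (h : IsCompl 𝔤.toSubmodule 𝔏.leib) :
    LieAlgebra.IsSimple ℂ 𝔤.toSubmodule := by
  let p := 𝔤.toSubmodule.projectionOnto 𝔏.leib h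
  refine hs.isSimple_of_ker_eq_leib hL (p := p) (Submodule.projectionOnto_surjective h)
    (fun x y => ?_) (Submodule.ker_projectionOnto h)
  have hsplit (x : L) : ∃ x₁ ∈ 𝔤.toSubmodule, ∃ x₂ ∈ 𝔏.leib, x₁ + x₂ = x :=
    Submodule.mem_sup.mp (by rw [h.sup_eq_top]; trivial)
  have hp (x₁ x₂ : L) (h₁ : x₁ ∈ 𝔤.toSubmodule) (h₂ : x₂ ∈ 𝔏.leib) : p (x₁ + x₂) = ⟨x₁, h₁⟩ := by
    rw [map_add, Submodule.projectionOnto_apply_of_mem_left h h₁,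
      (Submodule.projectionOnto_apply_eq_zero_iff h).mpr h₂, add_zero]
  obtain ⟨x₁, hx₁, x₂, hx₂, rfl⟩ := hsplit x
  obtain ⟨y₁, hy₁, y₂, hy₂, rfl⟩ := hsplit y
  have hbr : 𝔏.bracket (x₁ + x₂) (y₁ + y₂) = 𝔏.bracket x₁ y₁ + 𝔏.bracket x₁ y₂ := by
    rw [map_add 𝔏.bracket, LinearMap.add_apply, bracket_eq_zero_of_mem_leib hx₂, add_zero, map_add]
  rw [hp _ _ hx₁ hx₂, hp _ _ hy₁ hy₂, hbr,
    hp _ _ (𝔤.bracket_mem hx₁ hy₁) (bracket_mem_leib x₁ hy₂)]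
  rfl

attribute [local instance] LieRing.ofAssociativeRing

/-- The left multiplications of a simple Leibniz algebra `L` form a simple Lie algebra acting on
`L`; a complement of `Leib(L)` provided by Weyl's theorem is a Levi subalgebra. -/
theorem exists_isCompl_leib [FiniteDimensional ℂ L] :
    ∃ 𝔤 : 𝔏.LieSub, IsCompl 𝔤.toSubmodule 𝔏.leib := by
  let S : LieSubalgebra ℂ (Module.End ℂ L) :=
    { LinearMap.range 𝔏.bracket with
      lie_mem' := by
        rintro _ _ ⟨x, rfl⟩ ⟨y, rfl⟩
        refine ⟨𝔏.bracket x y, LinearMap.ext fun z => ?_⟩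
        rw [LieRing.of_associative_ring_bracket]
        simp [𝔏.leibniz x y z] }
  let p : L →ₗ[ℂ] S := 𝔏.bracket.codRestrict S.toSubmodule fun x => ⟨x, rfl⟩
  have hS : LieAlgebra.IsSimple ℂ S := by
    refine hs.isSimple_of_ker_eq_leib hL (p := p) ?_ (fun x y => ?_) ?_
    · rintro ⟨_, x, rfl⟩
      exact ⟨x, rfl⟩
    · refine Subtype.ext (LinearMap.ext fun z => ?_)
      change 𝔏.bracket (𝔏.bracket x y) z = (⁅𝔏.bracket x, 𝔏.bracket y⁆ : Module.End ℂ L) z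
      rw [LieRing.of_associative_ring_bracket]
      simp [𝔏.leibniz x y z]
    · refine (LinearMap.ker_codRestrict _ _ _).trans ?_
      exact hs.ker_bracket_eq_leib hL
  let W : LieSubmodule ℂ S L :=
    { 𝔏.leib with
      lie_mem := by
        rintro ⟨_, x, rfl⟩ z hz
        exact bracket_mem_leib x hz }
  obtain ⟨W', hW'⟩ := LieModule.exists_isCompl_of_isSimple W
  have hc : IsCompl (W' : Submodule ℂ L) 𝔏.leib := (LieSubmodule.isCompl_toSubmodule.mpr hW').symm
  have hstab (x : L) {y : L} (hy : y ∈ W') : 𝔏.bracket x y ∈ W' := W'.lie_mem (x := p x) hy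
  refine ⟨{ W'.toSubmodule with
    bracket_mem := fun {x y} _ hy => hstab x hy
    bracket_self := fun {x} hx => ?_ }, hc⟩
  have : 𝔏.bracket x x ∈ (W' : Submodule ℂ L) ⊓ 𝔏.leib := ⟨hstab x hx, bracket_self_mem_leib x⟩
  rwa [hc.inf_eq_bot] at this

end IsSimple

end LeibnizAlgebra

/-! ### Vertex algebroids that are simple Leibniz algebras -/

namespace VertexAlgebroid

variable {A B : Type*} [CommRing A] [Algebra ℂ A] [AddCommGroup B] [Module ℂ B]
  (V : VertexAlgebroid A B)

lemma bracket_d_left (a : A) (v : B) : V.bracket (V.d a) v = 0 := by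
  have h := V.bracket_add_bracket v (V.d a)
  rwa [V.pairing_d, V.bracket_d, add_eq_left] at h

lemma pairing_d_left (a : A) (v : B) : V.pairing (V.d a) v = V.anchor v a := by
  rw [V.pairing_symm, V.pairing_d]

lemma isIdeal_range_d : V.IsIdeal (LinearMap.range V.d) := by
  rintro x _ ⟨a, rfl⟩
  exact ⟨⟨_, (V.bracket_d x a).symm⟩, by rw [V.bracket_d_left]; exact Submodule.zero_mem _⟩

variable {V}

/-- If `∂(A) = B`, then the bracket of `B` is zero. -/
lemma range_d_ne_top (hL : ¬ V.toLeibnizAlgebra.IsLie) : LinearMap.range V.d ≠ ⊤ := fun h =>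
  hL fun x => by
    have hx : x ∈ LinearMap.range V.d := by rw [h]; trivial
    obtain ⟨a, rfl⟩ := hx
    exact V.bracket_d_left _ _

lemma range_d_eq_leib (hs : V.toLeibnizAlgebra.IsSimple) (hL : ¬ V.toLeibnizAlgebra.IsLie) :
    LinearMap.range V.d = V.leib := by
  rcases hs.eq_of_isIdeal _ V.isIdeal_range_d with h | h | h
  · refine absurd (fun x => ?_) hL
    have h1 := V.bracket_add_bracket x x
    have h2 : V.d (V.pairing x x) ∈ LinearMap.range V.d := ⟨_, rfl⟩
    rw [h, Submodule.mem_bot] at h2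
    rwa [h2, ← two_smul ℂ, smul_eq_zero_iff_right two_ne_zero] at h1
  · exact h
  · exact absurd h (range_d_ne_top hL)

/-- A Lie algebra inside `B` acts on `A` through the anchor. -/
instance (𝔤 : V.toLeibnizAlgebra.LieSub) : LieRingModule 𝔤.toSubmodule A where
  bracket x a := V.anchor x a
  add_lie x y a := by simp
  lie_add x a a' := by simp
  leibniz_lie x y a := by
    change V.anchor x (V.anchor y a) = V.anchor (V.bracket x y) a + V.anchor y (V.anchor x a)
    rw [V.anchor_bracket, Derivation.commutator_apply, sub_add_cancel]

lemma lie_eq_anchor {𝔤 : V.toLeibnizAlgebra.LieSub} (x : 𝔤.toSubmodule) (a : A) :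
    ⁅x, a⁆ = V.anchor x a := rfl

instance (𝔤 : V.toLeibnizAlgebra.LieSub) : LieModule ℂ 𝔤.toSubmodule A where
  smul_lie c x a := by simp [lie_eq_anchor]
  lie_smul c x a := by simp [lie_eq_anchor]

/-- The Levi decomposition `B = 𝔤 ⊕ ∂(A)` and a complement of the constants. -/
theorem exists_levi [FiniteDimensional ℂ A] [FiniteDimensional ℂ B]
    (hs : V.toLeibnizAlgebra.IsSimple) (hL : ¬ V.toLeibnizAlgebra.IsLie) :
    ∃ 𝔤 : V.toLeibnizAlgebra.LieSub,
      LieAlgebra.IsSimple ℂ 𝔤.toSubmodule ∧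
      IsCompl 𝔤.toSubmodule (LinearMap.range V.d) ∧
      V.RangeIsSimple 𝔤 ∧
      ∃ N : Submodule ℂ A, V.IsInvariantComplement 𝔤 N := by
  obtain ⟨𝔤, h𝔤⟩ := hs.exists_isCompl_leib hL
  have hsimple := hs.isSimple_of_isCompl hL h𝔤
  have hd := range_d_eq_leib hs hL
  refine ⟨𝔤, hsimple, hd ▸ h𝔤, ⟨?_, fun W hW hWs => ?_⟩, ?_⟩
  · rw [hd]
    exact LeibnizAlgebra.leib_ne_bot hL
  · have hideal : V.IsIdeal W := by
      intro x w hw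
      obtain ⟨a, rfl⟩ := hW hw
      refine ⟨?_, by rw [V.bracket_d_left]; exact W.zero_mem⟩
      have hx : x ∈ 𝔤.toSubmodule ⊔ LinearMap.range V.d := by rw [hd, h𝔤.sup_eq_top]; trivial
      obtain ⟨y, hy, _, ⟨a', rfl⟩, rfl⟩ := Submodule.mem_sup.mp hx
      rw [map_add, LinearMap.add_apply, V.bracket_d_left, add_zero]
      exact hWs y hy _ hw
    rcases hs.eq_of_isIdeal W hideal with h | h | h
    · exact Or.inl h
    · exact Or.inr (h.trans hd.symm)
    · exact absurd (top_le_iff.mp (h ▸ hW)) (range_d_ne_top hL)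
  · let W : LieSubmodule ℂ 𝔤.toSubmodule A :=
      { Submodule.span ℂ {(1 : A)} with
        lie_mem := by
          intro x a ha
          obtain ⟨c, rfl⟩ := Submodule.mem_span_singleton.mp ha
          simp [lie_eq_anchor] }
    obtain ⟨N, hN⟩ := LieModule.exists_isCompl_of_isSimple W
    exact ⟨N, fun x hx a ha => N.lie_mem (x := (⟨x, hx⟩ : 𝔤.toSubmodule)) ha,
      LieSubmodule.isCompl_toSubmodule.mpr hN⟩

section Structure

variable {𝔤 : V.toLeibnizAlgebra.LieSub} {N : Submodule ℂ A}

/-- The intersection `𝔤 ∩ ∂(A)` is an ideal of `𝔤`, and it is not `𝔤` because `∂(A) ≠ B`. -/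
lemma isCompl_of_sup_eq_top [LieAlgebra.IsSimple ℂ 𝔤.toSubmodule]
    (hL : ¬ V.toLeibnizAlgebra.IsLie) (hsup : 𝔤.toSubmodule ⊔ LinearMap.range V.d = ⊤) :
    IsCompl 𝔤.toSubmodule (LinearMap.range V.d) := by
  refine ⟨?_, codisjoint_iff.mpr hsup⟩
  let I : LieIdeal ℂ 𝔤.toSubmodule :=
    { (LinearMap.range V.d).comap 𝔤.toSubmodule.subtype with
      lie_mem := fun {x _} hy => (V.isIdeal_range_d x _ hy).1 }
  rcases LieAlgebra.IsSimple.eq_bot_or_eq_top I with h | h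
  · rw [disjoint_iff, eq_bot_iff]
    rintro x ⟨hx, hx'⟩
    have : (⟨x, hx⟩ : 𝔤.toSubmodule) ∈ I := hx'
    rw [h] at this
    exact congrArg Subtype.val ((LieSubmodule.mem_bot _).mp this)
  · refine absurd ?_ (range_d_ne_top hL)
    rw [← hsup, eq_comm, sup_eq_right]
    intro x hx
    have : (⟨x, hx⟩ : 𝔤.toSubmodule) ∈ I := by rw [h]; trivial
    exact this

/-- An invariant complement of the constants as a Lie submodule of `A`. -/
abbrev IsInvariantComplement.lieSubmodule (hN : V.IsInvariantComplement 𝔤 N) :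
    LieSubmodule ℂ 𝔤.toSubmodule A :=
  { N with lie_mem := fun {x _} ha => hN.1 x x.2 _ ha }

variable (hN : V.IsInvariantComplement 𝔤 N)

section

include hN

lemma IsInvariantComplement.exists_eq_smul_one_add (a : A) :
    ∃ (c : ℂ), ∃ n ∈ N, a = c • 1 + n := by
  have ha : a ∈ Submodule.span ℂ {(1 : A)} ⊔ N := by rw [hN.2.sup_eq_top]; trivial
  obtain ⟨y, hy, n, hn, rfl⟩ := Submodule.mem_sup.mp ha
  obtain ⟨c, rfl⟩ := Submodule.mem_span_singleton.mp hy
  exact ⟨c, n, hn, rfl⟩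

variable (hker : LinearMap.ker V.d = Submodule.span ℂ {1})
include hker

omit hN in
lemma d_one_of_ker_eq : V.d 1 = 0 := by
  rw [← LinearMap.mem_ker, hker]
  exact Submodule.mem_span_singleton_self 1

lemma IsInvariantComplement.eq_zero_of_d_eq_zero {a : A} (ha : a ∈ N) (h : V.d a = 0) : a = 0 := by
  rw [← LinearMap.mem_ker, hker] at h
  have : a ∈ Submodule.span ℂ {(1 : A)} ⊓ N := ⟨h, ha⟩
  rwa [hN.2.inf_eq_bot] at this

lemma IsInvariantComplement.exists_d_eq (a : A) : ∃ n ∈ N, V.d n = V.d a := by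
  obtain ⟨c, n, hn, rfl⟩ := hN.exists_eq_smul_one_add a
  exact ⟨n, hn, by simp [d_one_of_ker_eq hker]⟩

end

/-- `∂` identifies `N` with the simple module `∂(A)`. -/
lemma IsInvariantComplement.isIrreducible (hker : LinearMap.ker V.d = Submodule.span ℂ {1})
    (hR : V.RangeIsSimple 𝔤) : LieModule.IsIrreducible ℂ 𝔤.toSubmodule hN.lieSubmodule := by
  have hnt : Nontrivial hN.lieSubmodule := by
    by_contra! hsub
    refine hR.1 ((Submodule.eq_bot_iff _).mpr ?_)
    rintro _ ⟨a, rfl⟩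
    obtain ⟨n, hn, hna⟩ := hN.exists_d_eq hker a
    have h0 : (⟨n, hn⟩ : hN.lieSubmodule) = 0 := Subsingleton.elim _ _
    have hn0 : n = 0 := congrArg Subtype.val h0
    rw [← hna, hn0, map_zero]
  refine LieModule.IsIrreducible.mk fun W hW => ?_
  let D : hN.lieSubmodule →ₗ[ℂ] B := V.d ∘ₗ N.subtype
  have hD (n : hN.lieSubmodule) : D n = V.d n := rfl
  have hle : (W : Submodule ℂ hN.lieSubmodule).map D ≤ LinearMap.range V.d := by
    rintro _ ⟨n, -, rfl⟩
    exact ⟨n, rfl⟩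
  have hstab : ∀ x ∈ 𝔤.toSubmodule, ∀ w ∈ (W : Submodule ℂ hN.lieSubmodule).map D,
      V.bracket x w ∈ (W : Submodule ℂ hN.lieSubmodule).map D := by
    rintro x hx _ ⟨n, hn, rfl⟩
    exact ⟨⁅(⟨x, hx⟩ : 𝔤.toSubmodule), n⁆, W.lie_mem hn, (V.bracket_d x n).symm⟩
  rcases hR.2 _ hle hstab with h | h
  · refine absurd ((LieSubmodule.eq_bot_iff W).mpr fun n hn => ?_) hW
    have : D n ∈ (W : Submodule ℂ hN.lieSubmodule).map D := ⟨n, hn, rfl⟩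
    rw [h, Submodule.mem_bot] at this
    exact Subtype.ext (hN.eq_zero_of_d_eq_zero hker n.2 this)
  · rw [eq_top_iff]
    intro n _
    have : D n ∈ (W : Submodule ℂ hN.lieSubmodule).map D := by rw [h]; exact ⟨n, rfl⟩
    obtain ⟨n', hn', hnn'⟩ := this
    have heq : n' = n := by
      rw [← sub_eq_zero]
      exact Subtype.ext (hN.eq_zero_of_d_eq_zero hker (n' - n).2
        (by rw [← hD, map_sub, hnn', sub_self]))
    exact heq ▸ hn'

/-- If `𝔤` acted trivially on `N ≅ ∂(A)`, then `B` would be a Lie algebra. -/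
lemma IsInvariantComplement.not_isTrivial (hL : ¬ V.toLeibnizAlgebra.IsLie)
    (hker : LinearMap.ker V.d = Submodule.span ℂ {1})
    (hsup : 𝔤.toSubmodule ⊔ LinearMap.range V.d = ⊤) :
    ¬ LieModule.IsTrivial 𝔤.toSubmodule hN.lieSubmodule := by
  intro htriv
  refine hL fun x => ?_
  have hx : x ∈ 𝔤.toSubmodule ⊔ LinearMap.range V.d := by rw [hsup]; trivial
  obtain ⟨y, hy, _, ⟨a, rfl⟩, rfl⟩ := Submodule.mem_sup.mp hx
  obtain ⟨n, hn, hna⟩ := hN.exists_d_eq hker a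
  have h0 : V.anchor y n = 0 :=
    congrArg Subtype.val (htriv.trivial (⟨y, hy⟩ : 𝔤.toSubmodule) (⟨n, hn⟩ : hN.lieSubmodule))
  simp only [map_add, LinearMap.add_apply, V.bracket_d_left, add_zero, 𝔤.bracket_self hy,
    ← hna, V.bracket_d, h0, map_zero]

section Product

variable [LieModule.IsIrreducible ℂ 𝔤.toSubmodule hN.lieSubmodule]
  (hM : ¬ LieModule.IsTrivial 𝔤.toSubmodule hN.lieSubmodule)
  (hact : ∀ a ∈ N, ∀ v, V.act a v ∈ LinearMap.range V.d)

include hact in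
omit [LieModule.IsIrreducible ℂ 𝔤.toSubmodule hN.lieSubmodule] hN in
/-- Since `a · u` lies in `∂(A)`, it is annihilated by the anchor. -/
lemma mul_anchor_eq_zero {a : A} (ha : a ∈ N) (u : B) (a' : A) : a * V.anchor u a' = 0 := by
  obtain ⟨w, hw⟩ := hact a ha u
  have h := V.anchor_act a u
  rw [← hw, V.anchor_d] at h
  simpa using (congrArg (fun D => D a') h).symm

include hM hact in
/-- The annihilator of `N` in `N` is a submodule which contains `𝔤 N ≠ 0`. -/
lemma IsInvariantComplement.mul_eq_zero {a a' : A} (ha : a ∈ N) (ha' : a' ∈ N) : a * a' = 0 := by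
  let W : LieSubmodule ℂ 𝔤.toSubmodule hN.lieSubmodule :=
    { carrier := {n | ∀ a ∈ N, a * (n : A) = 0}
      add_mem' := fun {x y} hx hy a ha => by
        rw [LieSubmodule.coe_add, mul_add, hx a ha, hy a ha, add_zero]
      zero_mem' := fun a _ => mul_zero a
      smul_mem' := fun c x hx a ha => by
        rw [LieSubmodule.coe_smul, mul_smul_comm, hx a ha, smul_zero]
      lie_mem := fun {x n} _ a ha => mul_anchor_eq_zero hact ha x n }
  rcases IsSimpleOrder.eq_bot_or_eq_top W with h | h
  · refine absurd ⟨fun x n => ?_⟩ hM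
    have : ⁅x, n⁆ ∈ W := fun a ha => mul_anchor_eq_zero hact ha x n
    rwa [h] at this
  · have : (⟨a', ha'⟩ : hN.lieSubmodule) ∈ W := by rw [h]; trivial
    exact this a ha

include hM in
lemma IsInvariantComplement.eq_zero_of_forall_anchor_eq_zero {w : A} (hw : w ∈ N)
    (h : ∀ u ∈ 𝔤.toSubmodule, V.anchor u w = 0) : w = 0 := by
  have hmem : (⟨w, hw⟩ : hN.lieSubmodule) ∈
      LieModule.maxTrivSubmodule ℂ 𝔤.toSubmodule hN.lieSubmodule := fun x =>
    Subtype.ext (h x x.2)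
  rcases IsSimpleOrder.eq_bot_or_eq_top
    (LieModule.maxTrivSubmodule ℂ 𝔤.toSubmodule hN.lieSubmodule) with h' | h'
  · rw [h'] at hmem
    exact congrArg Subtype.val ((LieSubmodule.mem_bot _).mp hmem)
  · exact absurd ((LieModule.isTrivial_iff_max_triv_eq_top ℂ _ _).mpr h') hM

include hM hact in
/-- Write `a · ∂a' = ∂w` with `w ∈ N`. Pairing with `u ∈ 𝔤` gives `u_0 w = a * (u_0 a') = 0`. -/
lemma IsInvariantComplement.act_d_eq_zero (hker : LinearMap.ker V.d = Submodule.span ℂ {1})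
    {a : A} (ha : a ∈ N) (a' : A) : V.act a (V.d a') = 0 := by
  obtain ⟨w₀, hw₀⟩ := hact a ha (V.d a')
  obtain ⟨w, hw, hww⟩ := hN.exists_d_eq hker w₀
  rw [hw₀] at hww
  have hw0 : w = 0 := hN.eq_zero_of_forall_anchor_eq_zero hM hw fun u hu => by
    rw [← V.pairing_d_left, hww, V.pairing_act, V.pairing_d_left, V.anchor_d,
      Derivation.zero_apply, sub_zero]
    exact mul_anchor_eq_zero hact ha u a'
  rw [← hww, hw0, map_zero]

include hM hact in
/-- With `a · u = ∂(F u a)`, the axiom for `⟨a · u, v⟩` says `v (F u a) = φ(u, v) a - u v a`, which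
forces `F u a = u a`. -/
lemma IsInvariantComplement.act_eq_d_anchor [FiniteDimensional ℂ A] [FiniteDimensional ℂ B]
    [LieAlgebra.IsSimple ℂ 𝔤.toSubmodule] (hker : LinearMap.ker V.d = Submodule.span ℂ {1})
    {φ : LinearMap.BilinForm ℂ 𝔤.toSubmodule} (hs : φ.IsSymm)
    (hφ : ∀ x y : 𝔤.toSubmodule, φ x y • (1 : A) = V.pairing x y)
    {a : A} (ha : a ∈ N) {u : B} (hu : u ∈ 𝔤.toSubmodule) :
    V.act a u = V.d (V.anchor u a) := by
  have hinj : Function.Injective (V.d ∘ₗ N.subtype) := by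
    rw [← LinearMap.ker_eq_bot, Submodule.eq_bot_iff]
    exact fun n hn => Subtype.ext (hN.eq_zero_of_d_eq_zero hker n.2 hn)
  have hrange (a : N) (u : B) : V.act a u ∈ LinearMap.range (V.d ∘ₗ N.subtype) := by
    obtain ⟨w, hw⟩ := hact a a.2 u
    obtain ⟨n, hn, hnw⟩ := hN.exists_d_eq hker w
    exact ⟨⟨n, hn⟩, hnw.trans hw⟩
  let e := LinearEquiv.ofInjective (V.d ∘ₗ N.subtype) hinj
  let F : 𝔤.toSubmodule →ₗ[ℂ] hN.lieSubmodule →ₗ[ℂ] hN.lieSubmodule :=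
    LinearMap.mk₂ ℂ (fun u a => e.symm ⟨V.act a u, hrange a u⟩)
      (fun x y a => by rw [← map_add]; congr 1; ext; simp)
      (fun c x a => by rw [← map_smul]; congr 1; ext; simp)
      (fun x a a' => by rw [← map_add]; congr 1; ext; simp)
      (fun c x a => by rw [← map_smul]; congr 1; ext; simp)
  have hdF (u : 𝔤.toSubmodule) (a : hN.lieSubmodule) : V.d (F u a) = V.act a u :=
    congrArg Subtype.val (e.apply_symm_apply ⟨V.act a u, hrange a u⟩)
  have key := LieModule.eq_lie_of_lie_eq_smul_sub hM hs (F := F) (fun v u n => Subtype.ext ?_)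
    ⟨u, hu⟩ ⟨a, ha⟩
  · rw [← hdF ⟨u, hu⟩ ⟨a, ha⟩, key]
    rfl
  · change V.anchor v (F u n) = φ u v • (n : A) - V.anchor u (V.anchor v n)
    rw [← V.pairing_d_left, hdF, V.pairing_act, ← hφ, mul_smul_comm, mul_one]

end Product

end Structure

end VertexAlgebroid

/-! ### The isomorphism with the vertex algebroid of a Lie module -/

namespace VertexAlgebroid

variable {A B : Type*} [CommRing A] [Algebra ℂ A] [AddCommGroup B] [Module ℂ B]
  {V : VertexAlgebroid A B}

lemma Isomorphic.symm {A' B' : Type*} [CommRing A'] [Algebra ℂ A'] [AddCommGroup B'] [Module ℂ B']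
    {V' : VertexAlgebroid A' B'} (h : V.Isomorphic V') : V'.Isomorphic V := by
  obtain ⟨f, g, h⟩ := h
  have hf (a : A) : f a = f.toAlgHom a := rfl
  have hg (v : B) : g v = g.toLinearMap v := rfl
  refine ⟨f.symm, g.symm, ⟨fun u v => ?_, fun a v => ?_, fun u v => ?_, fun a => ?_, fun v a => ?_⟩⟩
  · refine g.injective ?_
    have := h.map_bracket (g.symm u) (g.symm v)
    simpa using this.symm
  · refine g.injective ?_
    have := h.map_act (f.symm a) (g.symm v)
    simpa using this.symm
  · refine f.injective ?_
    have := h.map_pairing (g.symm u) (g.symm v)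
    simpa using this.symm
  · refine g.injective ?_
    have := h.map_d (f.symm a)
    simpa using this.symm
  · refine f.injective ?_
    have := h.map_anchor (g.symm v) (f.symm a)
    simpa using this.symm

variable {𝔤 : V.toLeibnizAlgebra.LieSub} {N : Submodule ℂ A}

open TrivSqZeroExt in
/-- `𝔤 ⊕ M → B`, `u + m ↦ u + ∂(m)`, and `ℂ ⊕ M → A`, for `M ≅ N`, form an isomorphism. -/
lemma IsInvariantComplement.isomorphic_ofLieModule [Nontrivial A]
    (hN : V.IsInvariantComplement 𝔤 N)
    (hc : IsCompl 𝔤.toSubmodule (LinearMap.range V.d))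
    (hker : LinearMap.ker V.d = Submodule.span ℂ {1})
    (hmul : ∀ a ∈ N, ∀ a' ∈ N, a * a' = 0)
    (hact : ∀ a ∈ N, ∀ u ∈ 𝔤.toSubmodule, ∀ a' : A, V.act a (u + V.d a') = V.d (V.anchor u a))
    {M : Type*} [AddCommGroup M] [Module ℂ M] [Module ℂᵐᵒᵖ M] [IsCentralScalar ℂ M]
    [LieRingModule 𝔤.toSubmodule M] [LieModule ℂ 𝔤.toSubmodule M]
    (e : hN.lieSubmodule ≃ₗ⁅ℂ,𝔤.toSubmodule⁆ M)
    {φ : LinearMap.BilinForm ℂ 𝔤.toSubmodule}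
    (hφ : ∀ x y : 𝔤.toSubmodule, φ x y • (1 : A) = V.pairing x y) (hs : φ.IsSymm)
    (hi : φ.lieInvariant 𝔤.toSubmodule)
    (hM : ∀ (x y : 𝔤.toSubmodule) (m : M), ⁅x, ⁅y, m⁆⁆ + ⁅y, ⁅x, m⁆⁆ = φ x y • m) :
    V.Isomorphic (ofLieModule φ hs hi hM) := by
  refine Isomorphic.symm ?_
  have hd1 := d_one_of_ker_eq hker
  let j : M →ₗ[ℂ] A := N.subtype ∘ₗ (e.symm : M →ₗ[ℂ] hN.lieSubmodule)
  have hjN (m : M) : j m ∈ N := (e.symm m).2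
  have hjinj : Function.Injective j := Subtype.val_injective.comp e.symm.injective
  have hjsurj (n : A) (hn : n ∈ N) : ∃ m, j m = n := by
    obtain ⟨m, hm⟩ := e.symm.surjective ⟨n, hn⟩
    exact ⟨m, congrArg Subtype.val hm⟩
  have hjlie (x : 𝔤.toSubmodule) (m : M) : j ⁅x, m⁆ = V.anchor x (j m) :=
    congrArg Subtype.val (LieModuleHom.map_lie e.symm.toLieModuleHom x m)
  let f : TrivSqZeroExt ℂ M →ₐ[ℂ] A := AlgHom.ofLinearMap
    (LinearMap.toSpanSingleton ℂ A 1 ∘ₗ fstHom ℂ ℂ M + j ∘ₗ sndHom ℂ M) (by simp) (by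
      intro a a'
      have h0 : j a.snd * j a'.snd = 0 := hmul _ (hjN _) _ (hjN _)
      change (a * a').fst • (1 : A) + j (a * a').snd =
        (a.fst • (1 : A) + j a.snd) * (a'.fst • (1 : A) + j a'.snd)
      simp only [fst_mul, snd_mul, op_smul_eq_smul, map_add, map_smul, add_mul, mul_add,
        smul_mul_assoc, mul_smul_comm, one_mul, mul_one, h0, add_zero]
      module)
  have hf (a : TrivSqZeroExt ℂ M) : f a = a.fst • (1 : A) + j a.snd := rfl
  have hfbij : Function.Bijective f := by
    constructor
    · rw [injective_iff_map_eq_zero]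
      intro a ha
      rw [hf] at ha
      have hmem : a.fst • (1 : A) ∈ Submodule.span ℂ {(1 : A)} ⊓ N :=
        ⟨Submodule.smul_mem _ _ (Submodule.mem_span_singleton_self 1),
          by rw [eq_neg_of_add_eq_zero_left ha]; exact N.neg_mem (hjN _)⟩
      rw [hN.2.inf_eq_bot, Submodule.mem_bot, smul_eq_zero_iff_left one_ne_zero] at hmem
      rw [hmem, zero_smul, zero_add] at ha
      exact TrivSqZeroExt.ext hmem (hjinj (ha.trans (map_zero j).symm))
    · intro a
      obtain ⟨c, n, hn, rfl⟩ := hN.exists_eq_smul_one_add a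
      obtain ⟨m, rfl⟩ := hjsurj n hn
      exact ⟨inl c + inr m, by simp [hf]⟩
  let g : 𝔤.toSubmodule × M →ₗ[ℂ] B := 𝔤.toSubmodule.subtype.coprod (V.d ∘ₗ j)
  have hg (u : 𝔤.toSubmodule × M) : g u = u.1 + V.d (j u.2) := rfl
  have hgbij : Function.Bijective g := by
    constructor
    · rw [injective_iff_map_eq_zero]
      rintro ⟨u, m⟩ h
      rw [hg] at h
      have hmem : (u : B) ∈ 𝔤.toSubmodule ⊓ LinearMap.range V.d :=
        ⟨u.2, by rw [eq_neg_of_add_eq_zero_left h]; exact Submodule.neg_mem _ ⟨_, rfl⟩⟩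
      rw [hc.inf_eq_bot, Submodule.mem_bot] at hmem
      rw [hmem, zero_add] at h
      have hm := hN.eq_zero_of_d_eq_zero hker (hjN m) h
      exact Prod.ext (Subtype.ext hmem) (hjinj (hm.trans (map_zero j).symm))
    · intro v
      have hv : v ∈ 𝔤.toSubmodule ⊔ LinearMap.range V.d := by rw [hc.sup_eq_top]; trivial
      obtain ⟨x, hx, _, ⟨a, rfl⟩, rfl⟩ := Submodule.mem_sup.mp hv
      obtain ⟨n, hn, hna⟩ := hN.exists_d_eq hker a
      obtain ⟨m, rfl⟩ := hjsurj n hn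
      exact ⟨(⟨x, hx⟩, m), by rw [hg, hna]⟩
  refine ⟨AlgEquiv.ofBijective f hfbij, LinearEquiv.ofBijective g hgbij,
    ⟨fun u v => ?_, fun a v => ?_, fun u v => ?_, fun a => ?_, fun v a => ?_⟩⟩
  · change g (⁅u.1, v.1⁆, ⁅u.1, v.2⁆) = V.bracket (g u) (g v)
    rw [hg, hg, hg, hjlie, ← V.bracket_d, map_add V.bracket, LinearMap.add_apply, V.bracket_d_left,
      add_zero, map_add]
    rfl
  · change g (a.fst • v.1, a.fst • v.2 + ⁅v.1, a.snd⁆) = V.act (f a) (g v)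
    rw [hg, hg, hf, map_add V.act, LinearMap.add_apply, hact _ (hjN _) _ v.1.2, map_smul,
      LinearMap.smul_apply, V.one_act, map_add, hjlie, map_add, map_smul, map_smul, smul_add,
      ← add_assoc]
    rfl
  · change f (inl (φ u.1 v.1) + inr (⁅u.1, v.2⁆ + ⁅v.1, u.2⁆)) = V.pairing (g u) (g v)
    rw [hf, hg, hg]
    simp [hφ, hjlie, V.pairing_d, pairing_d_left, V.anchor_d]
    abel
  · change g (0, a.snd) = V.d (f a)
    rw [hg, hf, map_add, map_smul, hd1, smul_zero]
    rfl
  · change f (inr ⁅v.1, a.snd⁆) = V.anchor (g v) (f a)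
    rw [hf, hf, hg]
    simp [hjlie, V.anchor_d]

lemma IsInvariantComplement.isLocalRing [Nontrivial A] (hN : V.IsInvariantComplement 𝔤 N)
    (hmul : ∀ a ∈ N, ∀ a' ∈ N, a * a' = 0) : IsLocalRing A := by
  have key (c : ℂ) (hc : c ≠ 0) (n : A) (hn : n ∈ N) : IsUnit (c • 1 + n) := by
    refine IsUnit.of_mul_eq_one (c⁻¹ • 1 - (c⁻¹ * c⁻¹) • n) ?_
    simp only [mul_sub, add_mul, smul_mul_assoc, mul_smul_comm, one_mul, mul_one, hmul n hn n hn,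
      add_zero, smul_add, smul_smul, mul_assoc, inv_mul_cancel₀ hc, one_smul,
      add_sub_cancel_right]
  refine IsLocalRing.of_isUnit_or_isUnit_one_sub_self fun a => ?_
  obtain ⟨c, n, hn, rfl⟩ := hN.exists_eq_smul_one_add a
  by_cases hc : c = 0
  · right
    have := key 1 one_ne_zero (-n) (N.neg_mem hn)
    rw [one_smul, ← sub_eq_add_neg] at this
    simpa [hc] using this
  · exact Or.inl (key c hc n hn)

/-- The pairing on `𝔤` takes values in `Ker ∂ = ℂ1`, which makes it an invariant form. -/
lemma exists_bilinForm_pairing [Nontrivial A]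
    (hker : LinearMap.ker V.d = Submodule.span ℂ {1}) :
    ∃ φ : LinearMap.BilinForm ℂ 𝔤.toSubmodule,
      (∀ x y : 𝔤.toSubmodule, φ x y • (1 : A) = V.pairing x y) ∧ φ.IsSymm ∧
        φ.lieInvariant 𝔤.toSubmodule := by
  obtain ⟨f, hf, -⟩ := Submodule.exists_le_ker_of_notMem (p := (⊥ : Submodule ℂ A)) (v := 1)
    (by simp)
  let ε : A →ₗ[ℂ] ℂ := (f 1)⁻¹ • f
  have hε : ε 1 = 1 := by simp [ε, hf]
  let φ : LinearMap.BilinForm ℂ 𝔤.toSubmodule := LinearMap.mk₂ ℂ (fun x y => ε (V.pairing x y))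
    (by simp) (by simp) (by simp) (by simp)
  have hφ (x y : 𝔤.toSubmodule) : φ x y • (1 : A) = V.pairing x y := by
    have hmem : V.pairing x y ∈ LinearMap.ker V.d := by
      have hxy : V.bracket ((x : B) + y) (x + y) = 0 := 𝔤.bracket_self (x + y).2
      rw [LinearMap.mem_ker, ← V.bracket_add_bracket, ← hxy]
      simp only [map_add, LinearMap.add_apply, 𝔤.bracket_self x.2, 𝔤.bracket_self y.2]
      abel
    rw [hker] at hmem
    obtain ⟨c, hc⟩ := Submodule.mem_span_singleton.mp hmem
    change ε (V.pairing x y) • (1 : A) = _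
    rw [← hc, map_smul, hε, smul_eq_mul, mul_one]
  refine ⟨φ, hφ, ⟨fun x y => congrArg ε (V.pairing_symm x y)⟩, fun x y z => ?_⟩
  have h := V.anchor_pairing x y z
  rw [← hφ, Derivation.map_smul, Derivation.map_one_eq_zero, smul_zero, eq_comm] at h
  exact (congrArg ε (eq_neg_of_add_eq_zero_left h)).trans (map_neg ε _)

end VertexAlgebroid

theorem mainTheorem1 {A B : Type*} [CommRing A] [Algebra ℂ A] [FiniteDimensional ℂ A]
    [AddCommGroup B] [Module ℂ B] [FiniteDimensional ℂ B] (V : VertexAlgebroid A B)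
    (hsimple : V.toLeibnizAlgebra.IsSimple) (hnotLie : ¬ V.toLeibnizAlgebra.IsLie) :
    (∃ 𝔤 : V.toLeibnizAlgebra.LieSub,
      LieAlgebra.IsSimple ℂ 𝔤.toSubmodule ∧
      IsCompl 𝔤.toSubmodule (LinearMap.range V.d) ∧
      V.RangeIsSimple 𝔤 ∧
      ∃ N : Submodule ℂ A, V.IsInvariantComplement 𝔤 N) ∧
    ∀ (𝔤 : V.toLeibnizAlgebra.LieSub) [LieAlgebra.IsSimple ℂ 𝔤.toSubmodule]
      (N : Submodule ℂ A),
      𝔤.toSubmodule ⊔ LinearMap.range V.d = ⊤ →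
      V.RangeIsSimple 𝔤 →
      V.IsInvariantComplement 𝔤 N →
      (∃ u ∈ 𝔤.toSubmodule, ∃ v ∈ 𝔤.toSubmodule, V.pairing u v ≠ 0) →
      LinearMap.ker V.d = Submodule.span ℂ {1} →
      (∀ a ∈ N, ∀ v, V.act a v ∈ LinearMap.range V.d) →
      ∃ φ : LinearMap.BilinForm ℂ 𝔤.toSubmodule,
        (∀ x y : 𝔤.toSubmodule, φ x y • (1 : A) = V.pairing x y) ∧
        HighestWeight.IsNormalizedInvariantForm φ ∧
        IsLocalRing A ∧
        (∀ a ∈ N, ∀ a' ∈ N, a * a' = 0) ∧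
        (∀ a ∈ N, ∀ u ∈ 𝔤.toSubmodule, ∀ a' : A,
          V.act a (u + V.d a') = V.d (V.anchor u a)) ∧
        (∀ a ∈ N, ∀ u ∈ 𝔤.toSubmodule, ∀ v ∈ 𝔤.toSubmodule,
          V.anchor u (V.anchor v a) + V.anchor v (V.anchor u a) = V.pairing u v * a) ∧
        ∀ (H : LieSubalgebra ℂ 𝔤.toSubmodule) [H.IsCartanSubalgebra]
          (b : (LieAlgebra.IsKilling.rootSystem H).Base),
          ∃ lam : Module.Dual ℂ H, HighestWeight.IsDominantIntegral b lam ∧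
            ∃ (hs : φ.IsSymm) (hi : φ.lieInvariant 𝔤.toSubmodule)
              (hφ : ∀ (x y : 𝔤.toSubmodule) (m : HighestWeight.Irr b lam),
                ⁅x, ⁅y, m⁆⁆ + ⁅y, ⁅x, m⁆⁆ = φ x y • m),
              V.Isomorphic (VertexAlgebroid.ofLieModule φ hs hi hφ) := by
  refine ⟨VertexAlgebroid.exists_levi hsimple hnotLie, ?_⟩
  intro 𝔤 _ N hsup hR hN hpair hker hact
  obtain ⟨u₀, hu₀, v₀, hv₀, huv⟩ := hpair
  have : Nontrivial A := ⟨_, _, huv⟩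
  have hc := VertexAlgebroid.isCompl_of_sup_eq_top hnotLie hsup
  have hirr := hN.isIrreducible hker hR
  have hM := hN.not_isTrivial hnotLie hker hsup
  obtain ⟨φ, hφ, hs, hi⟩ := VertexAlgebroid.exists_bilinForm_pairing (𝔤 := 𝔤) hker
  have hmul : ∀ a ∈ N, ∀ a' ∈ N, a * a' = 0 := fun a ha a' ha' => hN.mul_eq_zero hM hact ha ha'
  have hact' : ∀ a ∈ N, ∀ u ∈ 𝔤.toSubmodule, V.act a u = V.d (V.anchor u a) :=
    fun a ha u hu => hN.act_eq_d_anchor hM hact hker hs hφ ha hu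
  have hact'' : ∀ a ∈ N, ∀ u ∈ 𝔤.toSubmodule, ∀ a' : A,
      V.act a (u + V.d a') = V.d (V.anchor u a) := fun a ha u hu a' => by
    rw [map_add, hact' a ha u hu, hN.act_d_eq_zero hM hact hker ha, add_zero]
  have hanti : ∀ a ∈ N, ∀ u ∈ 𝔤.toSubmodule, ∀ v ∈ 𝔤.toSubmodule,
      V.anchor u (V.anchor v a) + V.anchor v (V.anchor u a) = V.pairing u v * a := by
    intro a ha u hu v hv
    -- Pair `a · u = ∂(u_0 a)` with `v`.
    have h := V.pairing_act a u v
    rw [hact' a ha u hu, VertexAlgebroid.pairing_d_left] at h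
    rw [h, mul_comm]
    ring
  have hφN (x y : 𝔤.toSubmodule) (n : hN.lieSubmodule) : ⁅x, ⁅y, n⁆⁆ + ⁅y, ⁅x, n⁆⁆ = φ x y • n := by
    refine Subtype.ext ((hanti n n.2 x x.2 y y.2).trans ?_)
    rw [← hφ, smul_mul_assoc, one_mul]
    rfl
  have hφ0 : φ ≠ 0 := by
    rintro rfl
    exact huv (by simpa using (hφ ⟨u₀, hu₀⟩ ⟨v₀, hv₀⟩).symm)
  refine ⟨φ, hφ, HighestWeight.isNormalizedInvariantForm_of_anticommutator hM hs hi hφ0 hφN,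
    hN.isLocalRing hmul, hmul, hact'', hanti, fun H _ b => ?_⟩
  obtain ⟨lam, hlam, ⟨e⟩⟩ :=
    HighestWeight.exists_isDominantIntegral_nonempty_equiv b hN.lieSubmodule
  have hφM (x y : 𝔤.toSubmodule) (m : HighestWeight.Irr b lam) :
      ⁅x, ⁅y, m⁆⁆ + ⁅y, ⁅x, m⁆⁆ = φ x y • m := by
    obtain ⟨n, rfl⟩ := e.surjective m
    have h (z : 𝔤.toSubmodule) (n : hN.lieSubmodule) : e ⁅z, n⁆ = ⁅z, e n⁆ :=
      LieModuleHom.map_lie e.toLieModuleHom z n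
    rw [← h, ← h, ← h, ← h, ← map_add, hφN, map_smul]
  exact ⟨lam, hlam, hs, hi, hφM, hN.isomorphic_ofLieModule hc hker hmul hact'' e hφ hs hi hφM⟩
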